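/- Let $d\ge 1$ be an integer, $\mathbb{S}^d=\{x\in\mathbb{R}^{d+1}:\|x\|=1\}$ with surface area measure $\sigma_d$, and let $\mathcal{I}_\nu(x)=\sum_{m\ge 0}\frac{(x/2)^{2m+\nu}}{m!\,\Gamma(m+\nu+1)}$ denote the modified Bessel function of the first kind. For $\mu\in\mathbb{S}^d$ and $\kappa>0$, let $$f_{\mathrm{vMF}}(x;\mu,\kappa)=\frac{\kappa^{(d-1)/2}}{(2\pi)^{(d+1)/2}\mathcal{I}_{(d-1)/2}(\kappa)}\,e^{\kappa x^\top\mu},\qquad x\in\mathbb{S}^d,$$ be the von Mises--Fisher density. For $g:\mathbb{S}^d\to\mathbb{R}$ write $R(g)=\int_{\mathbb{S}^d}g^2\,d\sigma_d$. For a density $f$ on $\mathbb{S}^d$ let $\bar f(x)=f(x/\|x\|)$, $x\in\mathbb{R}^{d+1}\setminus\{0\}$, be its radial extension, let $\nabla^2\bar f$ be the Laplacian of $\bar f$ on $\mathbb{R}^{d+1}\setminus\{0\}$, and put $\rho_d(f)=R(f)/R(\nabla^2\bar f)^{d/(d+4)}$. Write $\rho_d(\kappa)=\rho_d(f_{\mathrm{vMF}}(\cdot;\mu,\kappa))$.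 Then, for every $d\ge1$, $\mu\in\mathbb{S}^d$ and $\kappa>0$, $$\rho_d(\kappa)=\mathcal{I}_{(d-1)/2}(2\kappa)\left\{4\pi^{2(1+1/d)}\,d\,\big(\mathcal{I}_{(d-1)/2}(\kappa)\big)^{8/d}\,\kappa^{2/d-1}\left[2d\,\mathcal{I}_{(d+1)/2}(2\kappa)+(d+2)\,\kappa\,\mathcal{I}_{(d+3)/2}(2\kappa)\right]\right\}^{-d/(d+4)}$$ (in particular, $\rho_d(\kappa)$ does not depend on $\mu$). Moreover, with $a\sim b$ meaning $a/b\to1$: (i) for every fixed $d\ge 1$, $\rho_d(\kappa)\sim\{4\pi^2d(d+2)\}^{-d/(d+4)}$ as $\kappa\to\infty$; (ii) for every fixed $\kappa>0$, $\rho_d(\kappa)\sim d\,\{4\pi^2e^2\kappa^2\}^{-1}$ as $d\to\infty$. -/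

import Mathlib

open MeasureTheory Filter Asymptotics

/-- The unit sphere `S^d ⊆ ℝ^{d+1}`. -/
abbrev UnitSphere (d : ℕ) : Type :=
  Metric.sphere (0 : EuclideanSpace ℝ (Fin (d + 1))) 1

/-- The surface area measure `σ_d` on `S^d`
(total mass `(d + 1) · vol (unit ball) = 2 π^((d+1)/2) / Γ((d+1)/2)`). -/
noncomputable def surfaceMeasure (d : ℕ) : Measure (UnitSphere d) :=
  (volume : Measure (EuclideanSpace ℝ (Fin (d + 1)))).toSphere

/-- The modified Bessel function of the first kind `I_ν(x)` for real order `ν`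
and real argument `x > 0`, by its power series. -/
noncomputable def besselI (ν x : ℝ) : ℝ :=
  ∑' m : ℕ, (x / 2) ^ (2 * (m : ℝ) + ν) / ((m.factorial : ℝ) * Real.Gamma (m + ν + 1))

/-- The normalizing constant of the von Mises–Fisher density. -/
noncomputable def vmfConst (d : ℕ) (κ : ℝ) : ℝ :=
  κ ^ (((d : ℝ) - 1) / 2) /
    ((2 * Real.pi) ^ (((d : ℝ) + 1) / 2) * besselI (((d : ℝ) - 1) / 2) κ)

/-- The von Mises–Fisher density on `S^d` with mean direction `μ` and concentration `κ`. -/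
noncomputable def vmfDensity (d : ℕ) (μ : UnitSphere d) (κ : ℝ) (x : UnitSphere d) : ℝ :=
  vmfConst d κ *
    Real.exp (κ * inner ℝ (x : EuclideanSpace ℝ (Fin (d + 1)))
      (μ : EuclideanSpace ℝ (Fin (d + 1))))

/-- The radial projection `x ↦ x / ‖x‖` of a nonzero vector onto the sphere. -/
noncomputable def radialProj {d : ℕ} (x : EuclideanSpace ℝ (Fin (d + 1))) (hx : x ≠ 0) :
    UnitSphere d :=
  ⟨‖x‖⁻¹ • x, by
    rw [mem_sphere_zero_iff_norm, norm_smul, norm_inv, norm_norm,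
      inv_mul_cancel₀ (norm_ne_zero_iff.mpr hx)]⟩

open Classical in
/-- The radial extension `x ↦ f (x / ‖x‖)` of a function on the sphere to `ℝ^{d+1} ∖ {0}`
(with the irrelevant value `0` at the origin). -/
noncomputable def radialExt {d : ℕ} (f : UnitSphere d → ℝ)
    (x : EuclideanSpace ℝ (Fin (d + 1))) : ℝ :=
  if hx : x ≠ 0 then f (radialProj x hx) else 0

/-- `R(g) = ∫_{S^d} g² dσ_d`. -/
noncomputable def sphereR {d : ℕ} (g : UnitSphere d → ℝ) : ℝ :=
  ∫ x, g x ^ 2 ∂(surfaceMeasure d)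

/-- The Laplacian on `ℝ^{d+1}` of the radial extension of `f`, restricted to the sphere. -/
noncomputable def laplacianExt {d : ℕ} (f : UnitSphere d → ℝ) (x : UnitSphere d) : ℝ :=
  Laplacian.laplacian (radialExt f) (x : EuclideanSpace ℝ (Fin (d + 1)))

/-- `ρ_d(f) = R(f) / R(∇² f̄)^{d/(d+4)}`. -/
noncomputable def rhoFunctional {d : ℕ} (f : UnitSphere d → ℝ) : ℝ :=
  sphereR f / sphereR (laplacianExt f) ^ ((d : ℝ) / ((d : ℝ) + 4))

/-- `ρ_d(κ) = ρ_d(f_vMF(·; μ, κ))`. -/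
noncomputable def rhoVMF (d : ℕ) (μ : UnitSphere d) (κ : ℝ) : ℝ :=
  rhoFunctional (vmfDensity d μ κ)

/-! Put `ν = (d-1)/2` and `t = ⟨x, μ⟩`. Since `I_ν(x) = (x/2)^ν G_ν((x/2)²)` with `G_ν` = `besselG`,
everything reduces to the entire functions `G_ν`, which satisfy `G_ν' = G_{ν+1}` and a three-term
recurrence.

Closed form. Integrating `t^k exp(-‖x‖²)` over `ℝ^{d+1}` in polar and in Cartesian coordinates gives
the moments of `t` on the sphere. Summed against the exponential series they yield `∫ e^{st} dσ =
2π^{(d+1)/2} G_ν((s/2)²)` (`sphereExpMoment_zero`). The Laplacian of the radial extension is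
`c(κ²(1-t²) - dκt)e^{κt}` on the sphere (`laplacianExt_vmfDensity`), so both values of `R` are
combinations of `s`-derivatives of this integral, of order at most four, at `s = 2κ`. The recurrence
leaves only `G_{ν+1}` and `G_{ν+2}` in the second one (`integral_laplacian_sq`).

Limits. Both are read off from the logarithm of the closed form (`rhoVMF_eq_exp`). As `κ → ∞`,
Poisson's integral and dominated convergence give `I_ν(x) ∼ e^x/√(2πx)` (`tendsto_besselI_atTop`),
and the terms in `κ` and `log κ` cancel. As `d → ∞`, `Γ(ν+1) G_ν(z) → 1` reduces the problem to `log
Γ((d+1)/2)`, handled by Stirling's formula and duplication (`tendsto_log_Gamma_half_div_sub_log`).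
-/

/-! ### Power series behind the Bessel functions. -/

/-- The entire part `∑ z^m / (m! Γ(m+ν+1))` of the modified Bessel function. -/
noncomputable def besselG (ν z : ℝ) : ℝ :=
  ∑' m : ℕ, z ^ m / ((m.factorial : ℝ) * Real.Gamma (m + ν + 1))

theorem Gamma_nat_add_pos {ν : ℝ} (hν : 0 ≤ ν) (m : ℕ) : 0 < Real.Gamma (m + ν + 1) :=
  Real.Gamma_pos_of_pos (by positivity)

/-- Each step multiplies by `m+ν+1 ≥ 1`; monotonicity of `Γ` is not available near `1`. This bound
dominates every series below by an exponential series. -/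
theorem Gamma_le_Gamma_nat_add {ν : ℝ} (hν : 0 ≤ ν) (m : ℕ) :
    Real.Gamma (ν + 1) ≤ Real.Gamma (m + ν + 1) := by
  induction m with
  | zero => simp
  | succ m ih =>
    have h : Real.Gamma (((m + 1 : ℕ) : ℝ) + ν + 1) = (m + ν + 1) * Real.Gamma (m + ν + 1) := by
      rw [← Real.Gamma_add_one (by positivity)]
      congr 1
      push_cast
      ring
    rw [h]
    have h2 := Gamma_nat_add_pos hν m
    have h3 : (1 : ℝ) ≤ m + ν + 1 := by
      have : (0 : ℝ) ≤ m := m.cast_nonneg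
      linarith
    nlinarith

theorem summable_pow_div_factorial_mul_Gamma {ν : ℝ} (hν : 0 ≤ ν) (z : ℝ) :
    Summable fun m : ℕ => z ^ m / ((m.factorial : ℝ) * Real.Gamma (m + ν + 1)) := by
  have hs : Summable fun m : ℕ => |z| ^ m / (m.factorial : ℝ) * (Real.Gamma (ν + 1))⁻¹ :=
    (Real.summable_pow_div_factorial |z|).mul_right _
  refine Summable.of_norm_bounded hs fun m => ?_
  have h1 := Gamma_nat_add_pos hν m
  have h2 := Gamma_le_Gamma_nat_add hν m
  have h3 : 0 < Real.Gamma (ν + 1) := Real.Gamma_pos_of_pos (by positivity)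
  rw [Real.norm_eq_abs, abs_div, abs_pow, abs_of_pos (by positivity : 0 < (m.factorial : ℝ) *
    Real.Gamma (m + ν + 1)), ← div_div, div_eq_mul_inv (_ / _)]
  gcongr

theorem besselG_hasSum {ν : ℝ} (hν : 0 ≤ ν) (z : ℝ) :
    HasSum (fun m : ℕ => z ^ m / ((m.factorial : ℝ) * Real.Gamma (m + ν + 1))) (besselG ν z) :=
  (summable_pow_div_factorial_mul_Gamma hν z).hasSum

theorem besselI_eq {ν x : ℝ} (hx : 0 < x) :
    besselI ν x = (x / 2) ^ ν * besselG ν ((x / 2) ^ 2) := by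
  rw [besselI, besselG, ← tsum_mul_left]
  refine tsum_congr fun m => ?_
  rw [Real.rpow_add (by positivity), Real.rpow_mul (by positivity), Real.rpow_natCast,
    Real.rpow_ofNat]
  ring

/-- Termwise differentiation, with a summable majorant on the ball of radius `|z|+1`. The factor `m`
cancels into `m!`, and shifting the index by one raises the order by one. -/
theorem besselG_hasDerivAt {ν : ℝ} (hν : 0 ≤ ν) (z : ℝ) :
    HasDerivAt (besselG ν) (besselG (ν + 1) z) z := by
  have hΓ : 0 < Real.Gamma (ν + 1) := Real.Gamma_pos_of_pos (by positivity)
  set R := |z| + 1 with hR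
  have hR0 : 0 < R := by positivity
  have hsum : Summable fun m : ℕ => (m : ℝ) * R ^ (m - 1) / (m.factorial : ℝ) *
      (Real.Gamma (ν + 1))⁻¹ := by
    refine Summable.mul_right _ ?_
    rw [← summable_nat_add_iff 1]
    refine (Real.summable_pow_div_factorial R).congr fun m => ?_
    rw [Nat.factorial_succ, Nat.add_sub_cancel]
    push_cast
    field_simp
  have key := hasDerivAt_tsum_of_isPreconnected
    (g := fun (m : ℕ) (y : ℝ) => y ^ m / ((m.factorial : ℝ) * Real.Gamma (m + ν + 1)))
    (g' := fun (m : ℕ) (y : ℝ) => (m : ℝ) * y ^ (m - 1) /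
      ((m.factorial : ℝ) * Real.Gamma (m + ν + 1)))
    (t := Metric.ball 0 R) (y₀ := z) (y := z) hsum Metric.isOpen_ball
    (convex_ball (0 : ℝ) R).isPreconnected
    (fun m y _ => (hasDerivAt_pow m y).div_const _) (fun m y hy => ?_)
    (by simp [hR]) (summable_pow_div_factorial_mul_Gamma hν z) (by simp [hR])
  · have hs : Summable fun m : ℕ => (m : ℝ) * z ^ (m - 1) /
        ((m.factorial : ℝ) * Real.Gamma (m + ν + 1)) := by
      rw [← summable_nat_add_iff 1]
      refine (summable_pow_div_factorial_mul_Gamma (ν := ν + 1) (by positivity) z).congr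
        fun m => ?_
      rw [Nat.factorial_succ, Nat.add_sub_cancel]
      push_cast
      rw [show (m : ℝ) + 1 + ν + 1 = m + (ν + 1) + 1 by ring]
      have := Gamma_nat_add_pos (ν := ν + 1) (by positivity) m
      field_simp
    suffices h : besselG (ν + 1) z = ∑' m : ℕ, (m : ℝ) * z ^ (m - 1) /
        ((m.factorial : ℝ) * Real.Gamma (m + ν + 1)) by
      rw [h]
      exact key
    rw [hs.tsum_eq_zero_add, besselG]
    simp only [Nat.cast_zero, zero_mul, zero_div, zero_add]
    refine tsum_congr fun m => ?_
    rw [Nat.factorial_succ, Nat.add_sub_cancel]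
    push_cast
    rw [show (m : ℝ) + 1 + ν + 1 = m + (ν + 1) + 1 by ring]
    have := Gamma_nat_add_pos (ν := ν + 1) (by positivity) m
    field_simp
  · have h1 := Gamma_nat_add_pos hν m
    have h2 := Gamma_le_Gamma_nat_add hν m
    have hy' : |y| ≤ R := by simpa using (Metric.mem_ball.mp hy).le
    rw [Real.norm_eq_abs, abs_div, abs_mul, abs_pow, Nat.abs_cast,
      abs_of_pos (by positivity : 0 < (m.factorial : ℝ) * Real.Gamma (m + ν + 1)),
      ← div_div, div_eq_mul_inv (_ / _)]
    gcongr

/-- By `Γ(m+ν+2) = (m+ν+1)Γ(m+ν+1)`, the `m`-th term of `G_ν` is `(ν+1)+m` times that of `G_{ν+1}`;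
the part with `m` is the shifted series of `z G_{ν+2}`. -/
theorem besselG_recurrence {ν : ℝ} (hν : 0 ≤ ν) (z : ℝ) :
    besselG ν z = (ν + 1) * besselG (ν + 1) z + z * besselG (ν + 2) z := by
  have h1 := (besselG_hasSum (ν := ν + 1) (by positivity) z).mul_left (ν + 1)
  have h2 := (besselG_hasSum (ν := ν + 2) (by positivity) z).mul_left z
  have h3 : HasSum (fun m : ℕ => (m : ℝ) * z ^ m /
      ((m.factorial : ℝ) * Real.Gamma (m + (ν + 1) + 1))) (z * besselG (ν + 2) z) := by
    rw [← hasSum_nat_add_iff' 1]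
    simp only [Finset.range_one, Finset.sum_singleton, Nat.cast_zero, zero_mul, zero_div, sub_zero]
    refine h2.congr_fun fun m => ?_
    have := Gamma_nat_add_pos (ν := ν + 2) (by positivity) m
    rw [Nat.factorial_succ]
    push_cast
    rw [show (m : ℝ) + 1 + (ν + 1) + 1 = m + (ν + 2) + 1 by ring]
    field_simp
    ring
  refine HasSum.unique (besselG_hasSum hν z) ((h1.add h3).congr_fun fun m => ?_)
  have := Gamma_nat_add_pos hν m
  have h4 : (0 : ℝ) < m + ν + 1 := by positivity
  rw [show (m : ℝ) + (ν + 1) + 1 = (m + ν + 1) + 1 by ring, Real.Gamma_add_one h4.ne']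
  generalize Real.Gamma (m + ν + 1) = g at *
  field_simp
  ring

theorem one_le_Gamma_mul_besselG {ν z : ℝ} (hν : 0 ≤ ν) (hz : 0 ≤ z) :
    1 ≤ Real.Gamma (ν + 1) * besselG ν z := by
  have h : 0 < Real.Gamma (ν + 1) := Real.Gamma_pos_of_pos (by positivity)
  have h0 := (besselG_hasSum hν z).summable.le_tsum 0 fun m _ => by
    have := Gamma_nat_add_pos hν m
    positivity
  simp only [pow_zero, Nat.factorial_zero, Nat.cast_one, Nat.cast_zero, zero_add, one_mul] at h0
  rw [← besselG] at h0
  calc 1 = Real.Gamma (ν + 1) * (1 / Real.Gamma (ν + 1)) := by field_simp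
    _ ≤ _ := by gcongr

theorem besselG_pos {ν z : ℝ} (hν : 0 ≤ ν) (hz : 0 ≤ z) : 0 < besselG ν z := by
  have h : 0 < Real.Gamma (ν + 1) := Real.Gamma_pos_of_pos (by positivity)
  have := one_le_Gamma_mul_besselG hν hz
  by_contra! h2
  nlinarith

theorem besselI_pos {ν x : ℝ} (hν : 0 ≤ ν) (hx : 0 < x) : 0 < besselI ν x := by
  rw [besselI_eq hx]
  have := besselG_pos hν (sq_nonneg (x / 2))
  positivity

/-- Past the leading term `1`, `Γ(ν+1)/Γ(m+ν+2) ≤ 1/(ν+1)` and `(m+1)! ≥ m!` leave an exponential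
series. With the lower bound `1` this drives the limit `d → ∞`. -/
theorem Gamma_mul_besselG_le {ν z : ℝ} (hν : 0 ≤ ν) (hz : 0 ≤ z) :
    Real.Gamma (ν + 1) * besselG ν z ≤ 1 + z * Real.exp z / (ν + 1) := by
  have h : 0 < Real.Gamma (ν + 1) := Real.Gamma_pos_of_pos (by positivity)
  have hs := (besselG_hasSum hν z).mul_left (Real.Gamma (ν + 1))
  rw [← hasSum_nat_add_iff' 1] at hs
  have he : HasSum (fun m : ℕ => z / (ν + 1) * (z ^ m / (m.factorial : ℝ)))
      (z / (ν + 1) * Real.exp z) := by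
    refine HasSum.mul_left _ ?_
    rw [Real.exp_eq_exp_ℝ]
    exact NormedSpace.expSeries_div_hasSum_exp z
  have := hasSum_le (fun m => ?_) hs he
  · simp only [Finset.range_one, Finset.sum_singleton, pow_zero, Nat.factorial_zero, Nat.cast_one,
      Nat.cast_zero, zero_add, one_mul] at this
    rw [mul_one_div_cancel h.ne'] at this
    have e : z / (ν + 1) * Real.exp z = z * Real.exp z / (ν + 1) := by ring
    linarith
  · have h1 := Gamma_le_Gamma_nat_add (ν := ν + 1) (by positivity) m
    rw [Real.Gamma_add_one (s := ν + 1) (by positivity)] at h1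
    have h2 := Gamma_nat_add_pos (ν := ν + 1) (by positivity) m
    have h3 : (m.factorial : ℝ) ≤ ((m + 1).factorial : ℝ) := by
      exact_mod_cast Nat.factorial_le (Nat.le_succ m)
    push_cast
    rw [show (m : ℝ) + 1 + ν + 1 = m + (ν + 1) + 1 by ring]
    have h4 : (0 : ℝ) < m.factorial := by positivity
    calc Real.Gamma (ν + 1) * (z ^ (m + 1) / (((m + 1).factorial : ℝ) *
          Real.Gamma (m + (ν + 1) + 1)))
        ≤ Real.Gamma (ν + 1) * (z ^ (m + 1) / ((m.factorial : ℝ) *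
          ((ν + 1) * Real.Gamma (ν + 1)))) := by gcongr
      _ = _ := by
        rw [pow_succ]
        field_simp

/-! ### Moments of `⟨x, μ⟩` on the sphere, by Gaussian integrals. -/

/-- Polar coordinates. -/
theorem integral_eq_integral_surfaceMeasure_prod (d : ℕ) (p : UnitSphere d → ℝ) (q : ℝ → ℝ) :
    ∫ x : (({0}ᶜ : Set (EuclideanSpace ℝ (Fin (d + 1))))),
        p (homeomorphUnitSphereProd _ x).1 * q ‖(x : EuclideanSpace ℝ (Fin (d + 1)))‖
          ∂(volume.comap Subtype.val) =
      (∫ x, p x ∂surfaceMeasure d) * ∫ r in Set.Ioi (0 : ℝ), r ^ d * q r := by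
  have h := (Measure.measurePreserving_homeomorphUnitSphereProd
    (volume : Measure (EuclideanSpace ℝ (Fin (d + 1))))).integral_comp
    (Homeomorph.measurableEmbedding _) (fun y => p y.1 * q y.2)
  simp only [homeomorphUnitSphereProd_apply_snd_coe] at h
  rw [h, integral_prod_mul p fun r : Set.Ioi (0 : ℝ) => q r, surfaceMeasure]
  congr 1
  have hd : Module.finrank ℝ (EuclideanSpace ℝ (Fin (d + 1))) - 1 = d := by simp
  simp only [hd, Measure.volumeIoiPow, ENNReal.ofReal]
  rw [integral_withDensity_eq_integral_smul,
    integral_subtype_comap measurableSet_Ioi fun a ↦ Real.toNNReal (a ^ d) • q a]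
  · refine setIntegral_congr_fun measurableSet_Ioi fun x hx ↦ ?_
    rw [NNReal.smul_def, Real.coe_toNNReal _ (pow_nonneg hx.out.le _), smul_eq_mul]
  · exact (measurable_subtype_coe.pow_const _).real_toNNReal

theorem integral_inner_pow_mul_exp_eq_sphere (d k : ℕ) (μ : UnitSphere d) :
    ∫ x : EuclideanSpace ℝ (Fin (d + 1)), inner ℝ x (μ : EuclideanSpace ℝ (Fin (d + 1))) ^ k *
        Real.exp (-‖x‖ ^ 2) =
      (∫ x, inner ℝ (x : EuclideanSpace ℝ (Fin (d + 1)))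
        (μ : EuclideanSpace ℝ (Fin (d + 1))) ^ k ∂surfaceMeasure d) *
        ∫ r in Set.Ioi (0 : ℝ), r ^ d * (r ^ k * Real.exp (-r ^ 2)) := by
  rw [← integral_eq_integral_surfaceMeasure_prod d (fun x =>
    inner ℝ (x : EuclideanSpace ℝ (Fin (d + 1))) (μ : EuclideanSpace ℝ (Fin (d + 1))) ^ k)
    (fun r => r ^ k * Real.exp (-r ^ 2))]
  have e := integral_subtype_comap (μ := volume)
    (measurableSet_singleton (0 : EuclideanSpace ℝ (Fin (d + 1)))).compl
    fun x => inner ℝ x (μ : EuclideanSpace ℝ (Fin (d + 1))) ^ k * Real.exp (-‖x‖ ^ 2)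
  rw [restrict_compl_singleton] at e
  rw [← e]
  congr 1
  funext x
  have hx : ‖(x : EuclideanSpace ℝ (Fin (d + 1)))‖ ≠ 0 := norm_ne_zero_iff.mpr x.2
  rw [homeomorphUnitSphereProd_apply_fst_coe, real_inner_smul_left, ← mul_assoc, ← mul_pow]
  congr 2
  field_simp

theorem integral_pow_mul_exp_neg_sq_Ioi (n : ℕ) :
    ∫ r in Set.Ioi (0 : ℝ), r ^ n * Real.exp (-r ^ 2) = 1 / 2 * Real.Gamma ((n + 1) / 2) := by
  rw [← integral_rpow_mul_exp_neg_rpow (p := 2) (q := n) (by norm_num)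
    (by linarith [(n.cast_nonneg : (0 : ℝ) ≤ n)])]
  refine setIntegral_congr_fun measurableSet_Ioi fun x _ => ?_
  simp

theorem integral_pow_mul_exp_neg_sq_even (j : ℕ) :
    ∫ r : ℝ, r ^ (2 * j) * Real.exp (-r ^ 2) = Real.Gamma (j + 1 / 2) := by
  have h := integral_comp_abs (f := fun r : ℝ => r ^ (2 * j) * Real.exp (-r ^ 2))
  simp only [pow_mul, sq_abs] at h
  simp only [pow_mul]
  rw [h]
  simp only [← pow_mul]
  rw [integral_pow_mul_exp_neg_sq_Ioi]
  push_cast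
  rw [show ((2 * (j : ℝ) + 1) / 2) = j + 1 / 2 by ring]
  ring

theorem integral_pow_mul_exp_neg_sq_odd (j : ℕ) :
    ∫ r : ℝ, r ^ (2 * j + 1) * Real.exp (-r ^ 2) = 0 := by
  have h := integral_neg_eq_self (fun r : ℝ => r ^ (2 * j + 1) * Real.exp (-r ^ 2)) volume
  have e : (fun r : ℝ => (-r) ^ (2 * j + 1) * Real.exp (-(-r) ^ 2)) =
      fun r => -(r ^ (2 * j + 1) * Real.exp (-r ^ 2)) := by
    funext r
    rw [Odd.neg_pow ⟨j, rfl⟩, neg_sq]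
    ring
  rw [e, integral_neg] at h
  linarith

theorem integral_inner_pow_mul_exp_neg_norm_sq (d k : ℕ) (μ : UnitSphere d) :
    ∫ x : EuclideanSpace ℝ (Fin (d + 1)), inner ℝ x (μ : EuclideanSpace ℝ (Fin (d + 1))) ^ k *
        Real.exp (-‖x‖ ^ 2) =
      (∫ r : ℝ, r ^ k * Real.exp (-r ^ 2)) * √Real.pi ^ d := by
  -- In an orthonormal basis with `b 0 = μ` the integrand is a product of one-variable functions:
  -- the power sits on coordinate `0`, and each of the other `d` coordinates contributes `√π`.
  obtain ⟨b, hb⟩ := Orthonormal.exists_orthonormalBasis_extension_of_card_eq (𝕜 := ℝ)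
    (E := EuclideanSpace ℝ (Fin (d + 1))) (ι := Fin (d + 1)) (by simp)
    (v := fun _ => (μ : EuclideanSpace ℝ (Fin (d + 1)))) (s := {0})
    ⟨fun i => by simp, fun i j hij => (hij (Subsingleton.elim i j)).elim⟩
  have hb0 : b 0 = μ := hb 0 rfl
  have h1 := b.measurePreserving_repr_symm.integral_comp
    b.repr.symm.toHomeomorph.measurableEmbedding
    (fun x => inner ℝ x (μ : EuclideanSpace ℝ (Fin (d + 1))) ^ k * Real.exp (-‖x‖ ^ 2))
  have h2 := (EuclideanSpace.volume_preserving_symm_measurableEquiv_toLp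
    (Fin (d + 1))).symm.integral_comp'
    (fun y : EuclideanSpace ℝ (Fin (d + 1)) =>
      inner ℝ (b.repr.symm y) (μ : EuclideanSpace ℝ (Fin (d + 1))) ^ k *
        Real.exp (-‖b.repr.symm y‖ ^ 2))
  rw [← h1, ← h2]
  have e : (fun y : Fin (d + 1) → ℝ =>
      inner ℝ (b.repr.symm ((MeasurableEquiv.toLp 2 (Fin (d + 1) → ℝ)).symm.symm y))
        (μ : EuclideanSpace ℝ (Fin (d + 1))) ^ k *
        Real.exp (-‖b.repr.symm ((MeasurableEquiv.toLp 2 (Fin (d + 1) → ℝ)).symm.symm y)‖ ^ 2)) =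
      fun y => ∏ i, (if i = 0 then fun r : ℝ => r ^ k * Real.exp (-r ^ 2)
        else fun r : ℝ => Real.exp (-r ^ 2)) (y i) := by
    funext y
    rw [LinearIsometryEquiv.norm_map, ← hb0, real_inner_comm, ← b.repr_apply_apply,
      LinearIsometryEquiv.apply_symm_apply, EuclideanSpace.norm_sq_eq, Fin.sum_univ_succ,
      Fin.prod_univ_succ]
    simp only [if_true, Fin.succ_ne_zero, if_false, ← Real.exp_sum]
    rw [mul_assoc, ← Real.exp_add]
    congr 2
    simp [Finset.sum_neg_distrib]
    ring
  rw [e, integral_fintype_prod_volume_eq_prod, Fin.prod_univ_succ]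
  have hg := integral_gaussian 1
  simp only [neg_mul, one_mul, div_one] at hg
  simp [Fin.succ_ne_zero, hg]

theorem integral_inner_pow_odd (d j : ℕ) (μ : UnitSphere d) :
    ∫ x, inner ℝ (x : EuclideanSpace ℝ (Fin (d + 1)))
        (μ : EuclideanSpace ℝ (Fin (d + 1))) ^ (2 * j + 1) ∂surfaceMeasure d = 0 := by
  have h := integral_inner_pow_mul_exp_eq_sphere d (2 * j + 1) μ
  rw [integral_inner_pow_mul_exp_neg_norm_sq, integral_pow_mul_exp_neg_sq_odd, zero_mul] at h
  simp only [← mul_assoc, ← pow_add] at h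
  rw [integral_pow_mul_exp_neg_sq_Ioi] at h
  -- The radial factor is positive, so the spherical factor must vanish.
  have : 0 < Real.Gamma (((d + (2 * j + 1) : ℕ) + 1 : ℝ) / 2) :=
    Real.Gamma_pos_of_pos (by positivity)
  rcases mul_eq_zero.mp h.symm with h | h
  · exact h
  · linarith

theorem integral_inner_pow_even (d j : ℕ) (μ : UnitSphere d) :
    ∫ x, inner ℝ (x : EuclideanSpace ℝ (Fin (d + 1)))
        (μ : EuclideanSpace ℝ (Fin (d + 1))) ^ (2 * j) ∂surfaceMeasure d =
      2 * √Real.pi ^ d * Real.Gamma (j + 1 / 2) / Real.Gamma (j + ((d : ℝ) - 1) / 2 + 1) := by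
  have h := integral_inner_pow_mul_exp_eq_sphere d (2 * j) μ
  rw [integral_inner_pow_mul_exp_neg_norm_sq, integral_pow_mul_exp_neg_sq_even] at h
  simp only [← mul_assoc, ← pow_add] at h
  rw [integral_pow_mul_exp_neg_sq_Ioi] at h
  push_cast at h
  rw [show ((d : ℝ) + 2 * j + 1) / 2 = j + ((d : ℝ) - 1) / 2 + 1 by ring] at h
  have : 0 < Real.Gamma (j + ((d : ℝ) - 1) / 2 + 1) :=
    Real.Gamma_pos_of_pos (by
      rw [show j + ((d : ℝ) - 1) / 2 + 1 = j + (d + 1) / 2 by ring]; positivity)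
  rw [eq_div_iff this.ne']
  linarith

/-! ### From moments to Bessel functions. -/

theorem hasSum_integral_exp_mul {Ω : Type*} [MeasurableSpace Ω] {m : Measure Ω}
    {X w : Ω → ℝ} (hX : AEStronglyMeasurable X m) (hX1 : ∀ᵐ ω ∂m, |X ω| ≤ 1)
    (hw : Integrable w m) (s : ℝ) :
    HasSum (fun k : ℕ => s ^ k / (k.factorial : ℝ) * ∫ ω, X ω ^ k * w ω ∂m)
      (∫ ω, Real.exp (s * X ω) * w ω ∂m) := by
  have h := hasSum_integral_of_dominated_convergence (μ := m)
    (F := fun (k : ℕ) ω => s ^ k / (k.factorial : ℝ) * (X ω ^ k * w ω))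
    (f := fun ω => Real.exp (s * X ω) * w ω)
    (fun k ω => |s| ^ k / (k.factorial : ℝ) * |w ω|) (fun k => ?_) (fun k => ?_) ?_ ?_ ?_
  · simpa only [integral_const_mul] using h
  · exact ((hX.pow k).mul hw.1).const_mul _
  · filter_upwards [hX1] with ω hω
    rw [Real.norm_eq_abs, abs_mul, abs_mul, abs_div, abs_pow, abs_pow, Nat.abs_cast]
    have : |X ω| ^ k ≤ 1 := pow_le_one₀ (abs_nonneg _) hω
    gcongr
    nlinarith [abs_nonneg (w ω)]
  · exact ae_of_all _ fun ω => (Real.summable_pow_div_factorial |s|).mul_right _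
  · simp only [tsum_mul_right]
    exact hw.abs.const_mul _
  · refine ae_of_all _ fun ω => ?_
    have h := (NormedSpace.expSeries_div_hasSum_exp (s * X ω)).mul_right (w ω)
    rw [← Real.exp_eq_exp_ℝ] at h
    refine h.congr_fun fun k => ?_
    rw [mul_pow]
    ring

/-- This turns the even part of the exponential series, with denominators `(2j)!`, into the series
of `besselG` at `(s/2)²`. -/
theorem Gamma_nat_add_half_div_factorial (j : ℕ) :
    Real.Gamma (j + 1 / 2) / ((2 * j).factorial : ℝ) = √Real.pi / (4 ^ j * (j.factorial : ℝ)) := by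
  induction j with
  | zero => simpa using Real.Gamma_one_half_eq
  | succ j ih =>
    have h : ((j + 1 : ℕ) : ℝ) + 1 / 2 = (j + 1 / 2) + 1 := by push_cast; ring
    rw [h, Real.Gamma_add_one (by positivity), show 2 * (j + 1) = 2 * j + 1 + 1 by ring,
      Nat.factorial_succ, Nat.factorial_succ, Nat.factorial_succ]
    rw [div_eq_div_iff (by positivity) (by positivity)] at ih ⊢
    push_cast
    rw [pow_succ]
    linear_combination (4 * ((j : ℝ) + 1 / 2) * (j + 1)) * ih

/-- A moment generating function with the even moments
`c Γ(j+1/2) / Γ(j+ν+1)` and vanishing odd moments is a Bessel function. -/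
theorem integral_exp_mul_eq_besselG {Ω : Type*} [MeasurableSpace Ω] {m : Measure Ω}
    {X w : Ω → ℝ} (hX : AEStronglyMeasurable X m) (hX1 : ∀ᵐ ω ∂m, |X ω| ≤ 1)
    (hw : Integrable w m) {c ν : ℝ} (hν : 0 ≤ ν)
    (hodd : ∀ j : ℕ, ∫ ω, X ω ^ (2 * j + 1) * w ω ∂m = 0)
    (heven : ∀ j : ℕ, ∫ ω, X ω ^ (2 * j) * w ω ∂m =
      c * Real.Gamma (j + 1 / 2) / Real.Gamma (j + ν + 1)) (s : ℝ) :
    ∫ ω, Real.exp (s * X ω) * w ω ∂m = c * √Real.pi * besselG ν ((s / 2) ^ 2) := by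
  refine (hasSum_integral_exp_mul hX hX1 hw s).unique ?_
  have h1 : HasSum (fun j : ℕ => s ^ (2 * j) / ((2 * j).factorial : ℝ) *
      ∫ ω, X ω ^ (2 * j) * w ω ∂m) (c * √Real.pi * besselG ν ((s / 2) ^ 2)) := by
    refine ((besselG_hasSum hν ((s / 2) ^ 2)).mul_left (c * √Real.pi)).congr_fun fun j => ?_
    have h2 := Gamma_nat_add_half_div_factorial j
    have h3 := Gamma_nat_add_pos hν j
    rw [heven, show s ^ (2 * j) / ((2 * j).factorial : ℝ) *
      (c * Real.Gamma (j + 1 / 2) / Real.Gamma (j + ν + 1)) = s ^ (2 * j) * c /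
      Real.Gamma (j + ν + 1) * (Real.Gamma (j + 1 / 2) / ((2 * j).factorial : ℝ)) by ring, h2]
    rw [div_pow, div_pow, pow_mul]
    norm_num
    field_simp
  have h2 : HasSum (fun j : ℕ => s ^ (2 * j + 1) / ((2 * j + 1).factorial : ℝ) *
      ∫ ω, X ω ^ (2 * j + 1) * w ω ∂m) 0 := by
    simp only [hodd, mul_zero]
    exact hasSum_zero
  have h := HasSum.even_add_odd
    (f := fun k : ℕ => s ^ k / (k.factorial : ℝ) * ∫ ω, X ω ^ k * w ω ∂m) h1 h2
  rwa [add_zero] at h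

/-! ### Exponential moments on the sphere and the integral of the squared Laplacian. -/

section Sphere

variable (d : ℕ) (μ : UnitSphere d)

theorem abs_inner_le_one (x : UnitSphere d) : |inner ℝ (x : EuclideanSpace ℝ (Fin (d + 1)))
    (μ : EuclideanSpace ℝ (Fin (d + 1)))| ≤ 1 := by
  simpa using abs_real_inner_le_norm (x : EuclideanSpace ℝ (Fin (d + 1)))
    (μ : EuclideanSpace ℝ (Fin (d + 1)))

theorem continuous_inner_sphere : Continuous fun x : UnitSphere d =>
    inner ℝ (x : EuclideanSpace ℝ (Fin (d + 1))) (μ : EuclideanSpace ℝ (Fin (d + 1))) := by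
  fun_prop

instance : IsFiniteMeasure (surfaceMeasure d) := by
  unfold surfaceMeasure
  infer_instance

theorem integrable_of_continuous_sphere {f : UnitSphere d → ℝ} (hf : Continuous f) :
    Integrable f (surfaceMeasure d) :=
  hf.integrable_of_hasCompactSupport (HasCompactSupport.of_compactSpace f)

/-- The `a`-th derivative in `s` of `∫ exp (s ⟨x, μ⟩) dσ`. -/
noncomputable def sphereExpMoment (a : ℕ) (s : ℝ) : ℝ :=
  ∫ x, inner ℝ (x : EuclideanSpace ℝ (Fin (d + 1))) (μ : EuclideanSpace ℝ (Fin (d + 1))) ^ a *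
    Real.exp (s * inner ℝ (x : EuclideanSpace ℝ (Fin (d + 1)))
      (μ : EuclideanSpace ℝ (Fin (d + 1)))) ∂surfaceMeasure d

theorem hasDerivAt_sphereExpMoment (a : ℕ) (s : ℝ) :
    HasDerivAt (sphereExpMoment d μ a) (sphereExpMoment d μ (a + 1) s) s := by
  refine ProbabilityTheory.hasDerivAt_integral_pow_mul_exp_real ?_ a
  have : ProbabilityTheory.integrableExpSet (fun x : UnitSphere d =>
      inner ℝ (x : EuclideanSpace ℝ (Fin (d + 1))) (μ : EuclideanSpace ℝ (Fin (d + 1))))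
      (surfaceMeasure d) = Set.univ := by
    refine Set.eq_univ_of_forall fun t => integrable_of_continuous_sphere d ?_
    fun_prop
  rw [this]
  simp

/-- The constant `2 π^((d+1)/2)`. -/
noncomputable def sphereConst (d : ℕ) : ℝ := 2 * √Real.pi ^ d * √Real.pi

theorem sphereExpMoment_zero (hd : 1 ≤ d) (s : ℝ) :
    sphereExpMoment d μ 0 s = sphereConst d * besselG (((d : ℝ) - 1) / 2) ((s / 2) ^ 2) := by
  have hd' : (1 : ℝ) ≤ d := by exact_mod_cast hd
  have h := integral_exp_mul_eq_besselG (m := surfaceMeasure d) (w := fun _ => 1)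
    (c := 2 * √Real.pi ^ d) (ν := ((d : ℝ) - 1) / 2)
    (continuous_inner_sphere d μ).aestronglyMeasurable (ae_of_all _ (abs_inner_le_one d μ))
    (integrable_const _) (by linarith)
    (fun j => by simpa using integral_inner_pow_odd d j μ)
    (fun j => by simpa using integral_inner_pow_even d j μ) s
  simpa [sphereExpMoment, sphereConst] using h

/-- Repeated differentiation of `sphereExpMoment_zero`. The argument `2u` makes the Bessel argument
`u²`; the chain-rule factor `2` on the left is the division by `2` in `step`. -/
theorem sphereExpMoment_formulas (hd : 1 ≤ d) (u : ℝ) :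
    sphereExpMoment d μ 0 (2 * u) = sphereConst d * besselG (((d : ℝ) - 1) / 2) (u ^ 2) ∧
    sphereExpMoment d μ 1 (2 * u) =
      sphereConst d * (u * besselG (((d : ℝ) - 1) / 2 + 1) (u ^ 2)) ∧
    sphereExpMoment d μ 2 (2 * u) =
      sphereConst d * (1 / 2 * besselG (((d : ℝ) - 1) / 2 + 1) (u ^ 2) +
        u ^ 2 * besselG (((d : ℝ) - 1) / 2 + 2) (u ^ 2)) ∧
    sphereExpMoment d μ 3 (2 * u) =
      sphereConst d * (3 / 2 * u * besselG (((d : ℝ) - 1) / 2 + 2) (u ^ 2) +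
        u ^ 3 * besselG (((d : ℝ) - 1) / 2 + 3) (u ^ 2)) ∧
    sphereExpMoment d μ 4 (2 * u) =
      sphereConst d * (3 / 4 * besselG (((d : ℝ) - 1) / 2 + 2) (u ^ 2) +
        3 * u ^ 2 * besselG (((d : ℝ) - 1) / 2 + 3) (u ^ 2) +
        u ^ 4 * besselG (((d : ℝ) - 1) / 2 + 4) (u ^ 2)) := by
  have hd' : (1 : ℝ) ≤ d := by exact_mod_cast hd
  set ν := ((d : ℝ) - 1) / 2 with hν
  have hν0 : 0 ≤ ν := by rw [hν]; linarith
  have hG : ∀ (n : ℝ), 0 ≤ n → ∀ u : ℝ, HasDerivAt (fun u => besselG (ν + n) (u ^ 2))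
      (besselG (ν + (n + 1)) (u ^ 2) * (2 * u)) u := fun n hn u => by
    have := (besselG_hasDerivAt (ν := ν + n) (by positivity) (u ^ 2)).comp u (hasDerivAt_pow 2 u)
    rw [← add_assoc]
    simpa [Function.comp_def] using this
  have hM : ∀ (a : ℕ) (u : ℝ), HasDerivAt (fun u => sphereExpMoment d μ a (2 * u))
      (sphereExpMoment d μ (a + 1) (2 * u) * 2) u := fun a u => by
    have := (hasDerivAt_sphereExpMoment d μ a (2 * u)).comp u ((hasDerivAt_id u).const_mul 2)
    simpa [Function.comp_def] using this
  have step : ∀ (a : ℕ) (g g' : ℝ → ℝ), (∀ u, HasDerivAt g (g' u) u) →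
      (∀ u, sphereExpMoment d μ a (2 * u) = sphereConst d * g u) →
      ∀ u, sphereExpMoment d μ (a + 1) (2 * u) = sphereConst d * (g' u / 2) := by
    intro a g g' hg hag u
    have h1 := hM a u
    rw [show (fun u => sphereExpMoment d μ a (2 * u)) = fun u => sphereConst d * g u from
      funext hag] at h1
    have h2 := h1.unique ((hg u).const_mul _)
    linarith
  have e1 : (0 : ℝ) + 1 = 1 := by norm_num
  have e2 : (1 : ℝ) + 1 = 2 := by norm_num
  have e3 : (2 : ℝ) + 1 = 3 := by norm_num
  have e4 : (3 : ℝ) + 1 = 4 := by norm_num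
  have m0 : ∀ u, sphereExpMoment d μ 0 (2 * u) = sphereConst d * besselG (ν + 0) (u ^ 2) := by
    intro u
    rw [sphereExpMoment_zero d μ hd, ← hν, add_zero]
    congr 3
    ring
  have G0 := hG 0 le_rfl
  have G1 := hG 1 (by norm_num)
  have G2 := hG 2 (by norm_num)
  have G3 := hG 3 (by norm_num)
  rw [e1] at G0
  rw [e2] at G1
  rw [e3] at G2
  rw [e4] at G3
  have m1 : ∀ u, sphereExpMoment d μ 1 (2 * u) =
      sphereConst d * (u * besselG (ν + 1) (u ^ 2)) := by
    intro u
    rw [step 0 _ _ G0 m0 u]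
    ring
  have m2 : ∀ u, sphereExpMoment d μ 2 (2 * u) =
      sphereConst d * (1 / 2 * besselG (ν + 1) (u ^ 2) + u ^ 2 * besselG (ν + 2) (u ^ 2)) := by
    intro u
    rw [step 1 _ _ (fun u => (hasDerivAt_id u).mul (G1 u)) m1 u]
    simp only [id]
    ring
  have m3 : ∀ u, sphereExpMoment d μ 3 (2 * u) =
      sphereConst d * (3 / 2 * u * besselG (ν + 2) (u ^ 2) +
        u ^ 3 * besselG (ν + 3) (u ^ 2)) := by
    intro u
    rw [step 2 _ _ (fun u => ((G1 u).const_mul (1 / 2)).add ((hasDerivAt_pow 2 u).mul (G2 u)))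
      m2 u]
    push_cast
    ring
  have m4 : ∀ u, sphereExpMoment d μ 4 (2 * u) =
      sphereConst d * (3 / 4 * besselG (ν + 2) (u ^ 2) + 3 * u ^ 2 * besselG (ν + 3) (u ^ 2) +
        u ^ 4 * besselG (ν + 4) (u ^ 2)) := by
    intro u
    rw [step 3 _ _ (fun u => (((hasDerivAt_id u).const_mul (3 / 2)).mul (G2 u)).add
      ((hasDerivAt_pow 3 u).mul (G3 u))) m3 u]
    simp only [id]
    push_cast
    ring
  refine ⟨?_, m1 u, m2 u, m3 u, m4 u⟩
  rw [m0 u, add_zero]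

theorem integral_laplacian_sq (hd : 1 ≤ d) (κ : ℝ) :
    ∫ x, ((κ ^ 2 * (1 - inner ℝ (x : EuclideanSpace ℝ (Fin (d + 1)))
        (μ : EuclideanSpace ℝ (Fin (d + 1))) ^ 2) - d * κ * inner ℝ
        (x : EuclideanSpace ℝ (Fin (d + 1))) (μ : EuclideanSpace ℝ (Fin (d + 1)))) *
        Real.exp (κ * inner ℝ (x : EuclideanSpace ℝ (Fin (d + 1)))
          (μ : EuclideanSpace ℝ (Fin (d + 1))))) ^ 2 ∂surfaceMeasure d =
      sphereConst d * (κ ^ 2 * d / 4 *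
        (2 * d * besselG (((d : ℝ) - 1) / 2 + 1) (κ ^ 2) +
          (d + 2) * κ ^ 2 * besselG (((d : ℝ) - 1) / 2 + 2) (κ ^ 2))) := by
  have hd' : (1 : ℝ) ≤ d := by exact_mod_cast hd
  have hI : ∀ a : ℕ, Integrable (fun x : UnitSphere d => inner ℝ
      (x : EuclideanSpace ℝ (Fin (d + 1))) (μ : EuclideanSpace ℝ (Fin (d + 1))) ^ a *
      Real.exp (2 * κ * inner ℝ (x : EuclideanSpace ℝ (Fin (d + 1)))
      (μ : EuclideanSpace ℝ (Fin (d + 1))))) (surfaceMeasure d) := fun a =>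
    integrable_of_continuous_sphere d (by fun_prop)
  have e : ∀ x : UnitSphere d, ((κ ^ 2 * (1 - inner ℝ (x : EuclideanSpace ℝ (Fin (d + 1)))
        (μ : EuclideanSpace ℝ (Fin (d + 1))) ^ 2) - d * κ * inner ℝ
        (x : EuclideanSpace ℝ (Fin (d + 1))) (μ : EuclideanSpace ℝ (Fin (d + 1)))) *
        Real.exp (κ * inner ℝ (x : EuclideanSpace ℝ (Fin (d + 1)))
          (μ : EuclideanSpace ℝ (Fin (d + 1))))) ^ 2 =
      -- Coefficients in `t` of `(κ²(1-t²) - dκt)²`; squaring the exponential doubles `κ`.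
      ∑ a : Fin 5, ![κ ^ 4, -2 * d * κ ^ 3, (d ^ 2 * κ ^ 2 - 2 * κ ^ 4), 2 * d * κ ^ 3, κ ^ 4] a *
        (inner ℝ (x : EuclideanSpace ℝ (Fin (d + 1))) (μ : EuclideanSpace ℝ (Fin (d + 1))) ^
          (a : ℕ) * Real.exp (2 * κ * inner ℝ (x : EuclideanSpace ℝ (Fin (d + 1)))
          (μ : EuclideanSpace ℝ (Fin (d + 1))))) := by
    intro x
    generalize inner ℝ (x : EuclideanSpace ℝ (Fin (d + 1)))
      (μ : EuclideanSpace ℝ (Fin (d + 1))) = t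
    rw [show 2 * κ * t = κ * t + κ * t by ring, Real.exp_add]
    simp [Fin.sum_univ_five]
    ring
  simp only [e]
  rw [integral_finsetSum _ fun (a : Fin 5) _ => (hI a).const_mul _]
  simp only [integral_const_mul]
  change ∑ a : Fin 5, _ * sphereExpMoment d μ a (2 * κ) = _
  obtain ⟨m0, m1, m2, m3, m4⟩ := sphereExpMoment_formulas d μ hd κ
  have hν0 : 0 ≤ ((d : ℝ) - 1) / 2 := by linarith
  have r0 := besselG_recurrence hν0 (κ ^ 2)
  have r1 := besselG_recurrence (ν := ((d : ℝ) - 1) / 2 + 1) (by positivity) (κ ^ 2)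
  have r2 := besselG_recurrence (ν := ((d : ℝ) - 1) / 2 + 2) (by positivity) (κ ^ 2)
  rw [show ((d : ℝ) - 1) / 2 + 1 + 1 = ((d : ℝ) - 1) / 2 + 2 by ring,
    show ((d : ℝ) - 1) / 2 + 1 + 2 = ((d : ℝ) - 1) / 2 + 3 by ring] at r1
  rw [show ((d : ℝ) - 1) / 2 + 2 + 1 = ((d : ℝ) - 1) / 2 + 3 by ring,
    show ((d : ℝ) - 1) / 2 + 2 + 2 = ((d : ℝ) - 1) / 2 + 4 by ring] at r2
  simp only [Fin.sum_univ_five]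
  simp only [Matrix.cons_val, Fin.val_zero, Fin.val_one, Fin.val_two, Fin.isValue]
  change _ * sphereExpMoment d μ 0 (2 * κ) + _ * sphereExpMoment d μ 1 (2 * κ) +
    _ * sphereExpMoment d μ 2 (2 * κ) + _ * sphereExpMoment d μ 3 (2 * κ) +
    _ * sphereExpMoment d μ 4 (2 * κ) = _
  rw [m0, m1, m2, m3, m4]
  generalize besselG (((d : ℝ) - 1) / 2) (κ ^ 2) = g0 at *
  generalize besselG (((d : ℝ) - 1) / 2 + 1) (κ ^ 2) = g1 at *
  generalize besselG (((d : ℝ) - 1) / 2 + 2) (κ ^ 2) = g2 at *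
  generalize besselG (((d : ℝ) - 1) / 2 + 3) (κ ^ 2) = g3 at *
  generalize besselG (((d : ℝ) - 1) / 2 + 4) (κ ^ 2) = g4 at *
  -- `r0` trades `g0` for `g1` and `g2`; `r2` removes `g4`, and `r1` then removes `g3`.
  linear_combination sphereConst d * κ ^ 4 * r0 -
    sphereConst d * κ ^ 4 * (2 * d - ((d : ℝ) - 1) / 2) * r1 - sphereConst d * κ ^ 6 * r2

end Sphere

/-! ### The Laplacian of the radial extension. -/

section Laplacian

open scoped Topology

variable {E : Type*} [NormedAddCommGroup E] [InnerProductSpace ℝ E]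

theorem hasDerivAt_norm_add_smul {x v : E} {t : ℝ} (h : x + t • v ≠ 0) :
    HasDerivAt (fun t : ℝ => ‖x + t • v‖) (inner ℝ (x + t • v) v / ‖x + t • v‖) t := by
  have h1 : HasDerivAt (fun t : ℝ => x + t • v) v t := by
    simpa using ((hasDerivAt_id t).smul_const v).const_add x
  have h2 := h1.norm_sq.sqrt (by simpa using h)
  simp only [Real.sqrt_sq (norm_nonneg _)] at h2
  convert h2 using 1
  field_simp

/-- Reduces a second directional derivative to one-variable calculus along the line `x + t • v`. -/
theorem hasDerivAt_fderiv_add_smul {f : E → ℝ} {x : E} (hf : ContDiffAt ℝ 2 f x) (v : E) :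
    HasDerivAt (fun t : ℝ => fderiv ℝ f (x + t • v) v) (iteratedFDeriv ℝ 2 f x ![v, v]) 0 := by
  have hd2 : DifferentiableAt ℝ (fderiv ℝ f) x :=
    (hf.fderiv_right (m := 1) (by norm_num)).differentiableAt (by norm_num)
  have hline : HasDerivAt (fun t : ℝ => x + t • v) v 0 := by
    simpa using ((hasDerivAt_id (0 : ℝ)).smul_const v).const_add x
  have h3 : HasDerivAt (fun t : ℝ => fderiv ℝ f (x + t • v)) (fderiv ℝ (fderiv ℝ f) x v) 0 :=
    hd2.hasFDerivAt.comp_hasDerivAt_of_eq (0 : ℝ) hline (by simp)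
  have h4 := (ContinuousLinearMap.apply ℝ ℝ v).hasFDerivAt.comp_hasDerivAt (0 : ℝ) h3
  rw [iteratedFDeriv_two_apply]
  exact h4

/-- The second directional derivative of `c exp (κ ⟨x, μ⟩ / ‖x‖)` at a unit vector. -/
theorem second_directional_derivative {x μ v : E} (hx : ‖x‖ = 1) (c κ : ℝ) :
    iteratedFDeriv ℝ 2 (fun y : E => c * Real.exp (κ * (inner ℝ y μ / ‖y‖))) x ![v, v] =
      c * Real.exp (κ * inner ℝ x μ) *
        (κ * (inner ℝ x μ * (3 * inner ℝ x v ^ 2 - ‖v‖ ^ 2) - 2 * inner ℝ v μ * inner ℝ x v) +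
          κ ^ 2 * (inner ℝ v μ - inner ℝ x μ * inner ℝ x v) ^ 2) := by
  set f : E → ℝ := fun y : E => c * Real.exp (κ * (inner ℝ y μ / ‖y‖)) with hf
  have hx0 : x ≠ 0 := by
    rintro rfl
    simp at hx
  have hsm : ∀ y : E, y ≠ 0 → ContDiffAt ℝ 2 f y := fun y hy => by
    have := contDiffAt_norm ℝ (n := 2) hy
    have hy' : ‖y‖ ≠ 0 := norm_ne_zero_iff.mpr hy
    refine contDiffAt_const.mul (ContDiffAt.exp (contDiffAt_const.mul (ContDiffAt.div ?_ this hy')))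
    exact contDiffAt_id.inner ℝ contDiffAt_const
  have hline : ∀ t : ℝ, HasDerivAt (fun t : ℝ => x + t • v) v t := fun t => by
    simpa using ((hasDerivAt_id t).smul_const v).const_add x
  have hne : ∀ᶠ t : ℝ in 𝓝 0, x + t • v ≠ 0 := by
    have : ContinuousAt (fun t : ℝ => x + t • v) 0 := (hline 0).continuousAt
    refine this.eventually_ne ?_
    simpa using hx0
  have hinner : ∀ t : ℝ, ∀ w : E, HasDerivAt (fun t : ℝ => inner ℝ (x + t • v) w) (inner ℝ v w) t :=
    fun t w => by simpa using (hline t).inner ℝ (hasDerivAt_const t w)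
  -- The first derivative is needed on a neighbourhood of `t = 0`, since it is differentiated again.
  have hfst : ∀ᶠ t : ℝ in 𝓝 0, fderiv ℝ f (x + t • v) v =
      c * (Real.exp (κ * (inner ℝ (x + t • v) μ / ‖x + t • v‖)) *
        (κ * ((inner ℝ v μ * ‖x + t • v‖ - inner ℝ (x + t • v) μ *
          (inner ℝ (x + t • v) v / ‖x + t • v‖)) / ‖x + t • v‖ ^ 2))) := by
    filter_upwards [hne] with t ht
    have h1 := (((hsm _ ht).differentiableAt (by norm_num)).hasFDerivAt).comp_hasDerivAt t (hline t)
    have h2 := (((((hinner t μ).div (hasDerivAt_norm_add_smul ht)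
      (norm_ne_zero_iff.mpr ht)).const_mul κ).exp).const_mul c)
    exact h1.unique h2
  have hx1 : x + (0 : ℝ) • v = x := by simp
  have h1 := hasDerivAt_fderiv_add_smul (hsm x hx0) v
  have h0 : x + (0 : ℝ) • v ≠ 0 := by rwa [hx1]
  have hn := norm_ne_zero_iff.mpr h0
  have hnorm := hasDerivAt_norm_add_smul h0
  have hquot := (hinner 0 μ).div hnorm hn
  have hnum := ((hnorm.const_mul (inner ℝ v μ)).sub
    ((hinner 0 μ).mul ((hinner 0 v).div hnorm hn))).div (hnorm.pow 2) (pow_ne_zero 2 hn)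
  have h2 := ((hquot.const_mul κ).exp.mul (hnum.const_mul κ)).const_mul c
  have h3 := h1.unique (h2.congr_of_eventuallyEq hfst)
  rw [h3]
  simp only [hx1, hx, Pi.mul_apply, Pi.div_apply, Pi.sub_apply, Pi.pow_apply, real_inner_self_eq_norm_sq,
    div_one]
  ring

end Laplacian

theorem laplacianExt_vmfDensity (d : ℕ) (μ x : UnitSphere d) (κ : ℝ) :
    laplacianExt (vmfDensity d μ κ) x = vmfConst d κ *
      ((κ ^ 2 * (1 - inner ℝ (x : EuclideanSpace ℝ (Fin (d + 1)))
        (μ : EuclideanSpace ℝ (Fin (d + 1))) ^ 2) - d * κ * inner ℝ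
        (x : EuclideanSpace ℝ (Fin (d + 1))) (μ : EuclideanSpace ℝ (Fin (d + 1)))) *
        Real.exp (κ * inner ℝ (x : EuclideanSpace ℝ (Fin (d + 1)))
          (μ : EuclideanSpace ℝ (Fin (d + 1))))) := by
  have hx : ‖(x : EuclideanSpace ℝ (Fin (d + 1)))‖ = 1 := by simp
  have hμ : ‖(μ : EuclideanSpace ℝ (Fin (d + 1)))‖ = 1 := by simp
  have hx0 : (x : EuclideanSpace ℝ (Fin (d + 1))) ≠ 0 := by
    intro h
    simp [h] at hx
  have hev : radialExt (vmfDensity d μ κ) =ᶠ[nhds (x : EuclideanSpace ℝ (Fin (d + 1)))]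
      fun y => vmfConst d κ * Real.exp (κ * (inner ℝ y
        (μ : EuclideanSpace ℝ (Fin (d + 1))) / ‖y‖)) := by
    filter_upwards [isOpen_compl_singleton.mem_nhds hx0] with y hy
    rw [radialExt, dif_pos (show y ≠ 0 from hy), vmfDensity, radialProj, real_inner_smul_left, inv_mul_eq_div]
  rw [laplacianExt, (InnerProductSpace.laplacian_congr_nhds hev).eq_of_nhds]
  have b := EuclideanSpace.basisFun (Fin (d + 1)) ℝ
  rw [InnerProductSpace.laplacian_eq_iteratedFDeriv_orthonormalBasis _ b]
  simp only [second_directional_derivative hx, b.norm_eq_one]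
  rw [← Finset.mul_sum]
  -- Parseval evaluates every sum over the basis; the leftover `-κp` occurs `d+1` times, and `3κp -
  -- 2κp - (d+1)κp = -dκp`.
  have s1 : ∑ i, inner ℝ (x : EuclideanSpace ℝ (Fin (d + 1))) (b i) ^ 2 = 1 := by
    rw [b.sum_sq_inner_left, hx, one_pow]
  have s2 : ∑ i, inner ℝ (b i) (μ : EuclideanSpace ℝ (Fin (d + 1))) ^ 2 = 1 := by
    rw [b.sum_sq_inner_right, hμ, one_pow]
  have s3 := b.sum_inner_mul_inner (x : EuclideanSpace ℝ (Fin (d + 1)))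
    (μ : EuclideanSpace ℝ (Fin (d + 1)))
  generalize inner ℝ (x : EuclideanSpace ℝ (Fin (d + 1))) (μ : EuclideanSpace ℝ (Fin (d + 1))) = p
    at *
  have e : ∀ i, κ * (p * (3 * inner ℝ (x : EuclideanSpace ℝ (Fin (d + 1))) (b i) ^ 2 - 1 ^ 2) -
      2 * inner ℝ (b i) (μ : EuclideanSpace ℝ (Fin (d + 1))) *
        inner ℝ (x : EuclideanSpace ℝ (Fin (d + 1))) (b i)) +
      κ ^ 2 * (inner ℝ (b i) (μ : EuclideanSpace ℝ (Fin (d + 1))) -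
        p * inner ℝ (x : EuclideanSpace ℝ (Fin (d + 1))) (b i)) ^ 2 =
      (3 * κ * p + κ ^ 2 * p ^ 2) * inner ℝ (x : EuclideanSpace ℝ (Fin (d + 1))) (b i) ^ 2 +
      κ ^ 2 * inner ℝ (b i) (μ : EuclideanSpace ℝ (Fin (d + 1))) ^ 2 -
      (2 * κ + 2 * κ ^ 2 * p) * (inner ℝ (x : EuclideanSpace ℝ (Fin (d + 1))) (b i) *
        inner ℝ (b i) (μ : EuclideanSpace ℝ (Fin (d + 1)))) - κ * p := by
    intro i
    ring
  simp only [e, Finset.sum_sub_distrib, Finset.sum_add_distrib, ← Finset.mul_sum, s1, s2, s3]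
  simp
  ring

/-! ### The closed form of `ρ_d(κ)`. -/

theorem sphereR_vmfDensity (d : ℕ) (hd : 1 ≤ d) (μ : UnitSphere d) (κ : ℝ) :
    sphereR (vmfDensity d μ κ) =
      vmfConst d κ ^ 2 * (sphereConst d * besselG (((d : ℝ) - 1) / 2) (κ ^ 2)) := by
  rw [← (sphereExpMoment_formulas d μ hd κ).1, sphereR, sphereExpMoment, ← integral_const_mul]
  congr 1
  funext x
  rw [vmfDensity, mul_pow, ← Real.exp_nat_mul]
  push_cast
  rw [pow_zero, one_mul, mul_assoc]

theorem sphereR_laplacianExt_vmfDensity (d : ℕ) (hd : 1 ≤ d) (μ : UnitSphere d) (κ : ℝ) :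
    sphereR (laplacianExt (vmfDensity d μ κ)) =
      vmfConst d κ ^ 2 * (sphereConst d * (κ ^ 2 * d / 4 *
        (2 * d * besselG (((d : ℝ) - 1) / 2 + 1) (κ ^ 2) +
          (d + 2) * κ ^ 2 * besselG (((d : ℝ) - 1) / 2 + 2) (κ ^ 2)))) := by
  rw [← integral_laplacian_sq d μ hd κ, sphereR, ← integral_const_mul]
  congr 1
  funext x
  rw [laplacianExt_vmfDensity, mul_pow]

theorem sphereConst_eq (d : ℕ) : sphereConst d = 2 * Real.pi ^ (((d : ℝ) + 1) / 2) := by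
  rw [sphereConst, mul_assoc, ← pow_succ, Real.sqrt_eq_rpow, ← Real.rpow_natCast,
    ← Real.rpow_mul Real.pi_pos.le]
  push_cast
  congr 2
  ring

/-- `c² · 2π^((d+1)/2) · κ^(-ν)` in terms of Bessel functions. -/
theorem vmfConst_sq_mul_sphereConst (d : ℕ) (hd : 1 ≤ d) {κ : ℝ} (hκ : 0 < κ) :
    vmfConst d κ ^ 2 * sphereConst d * (κ ^ (((d : ℝ) - 1) / 2))⁻¹ =
      κ ^ (((d : ℝ) - 1) / 2) * ((2 : ℝ) ^ d * Real.pi ^ (((d : ℝ) + 1) / 2) *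
        besselI (((d : ℝ) - 1) / 2) κ ^ 2)⁻¹ := by
  have hd' : (1 : ℝ) ≤ d := by exact_mod_cast hd
  have hI : 0 < besselI (((d : ℝ) - 1) / 2) κ := besselI_pos (by linarith) hκ
  have hκν : 0 < κ ^ (((d : ℝ) - 1) / 2) := by positivity
  have hπ : 0 < Real.pi ^ (((d : ℝ) + 1) / 2) := by positivity
  have h2 : ((2 : ℝ) ^ (((d : ℝ) + 1) / 2)) ^ 2 = 2 ^ d * 2 := by
    rw [← Real.rpow_natCast, ← Real.rpow_mul (by norm_num), ← pow_succ, ← Real.rpow_natCast]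
    congr 1
    push_cast
    ring
  rw [vmfConst, sphereConst_eq, Real.mul_rpow (by norm_num) Real.pi_pos.le, div_pow, mul_pow,
    mul_pow, h2]
  field_simp

theorem besselI_two_mul (ν n : ℝ) {κ : ℝ} (hκ : 0 < κ) :
    besselI (ν + n) (2 * κ) = κ ^ ν * κ ^ n * besselG (ν + n) (κ ^ 2) := by
  rw [besselI_eq (by positivity), mul_div_cancel_left₀ _ two_ne_zero, Real.rpow_add hκ]

theorem log_rhoVMF_base (d : ℕ) (hd : 1 ≤ d) {κ : ℝ} (hκ : 0 < κ) {W : ℝ} (hW0 : 0 < W) :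
    Real.log (4 * Real.pi ^ (2 * (1 + 1 / (d : ℝ))) * (d : ℝ) *
      besselI (((d : ℝ) - 1) / 2) κ ^ (8 / (d : ℝ)) * κ ^ (2 / (d : ℝ) - 1) * W) =
      2 * Real.log 2 + 2 * (1 + 1 / (d : ℝ)) * Real.log Real.pi + Real.log d + 8 / (d : ℝ) *
      Real.log (besselI (((d : ℝ) - 1) / 2) κ) + (2 / (d : ℝ) - 1) * Real.log κ +
      Real.log W := by
  have hd' : (1 : ℝ) ≤ d := by exact_mod_cast hd
  have hI : 0 < besselI (((d : ℝ) - 1) / 2) κ := besselI_pos (by linarith) hκ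
  have hπ := Real.pi_pos
  have hl4 : Real.log 4 = 2 * Real.log 2 := by
    rw [show (4 : ℝ) = 2 ^ 2 by norm_num, Real.log_pow]
    norm_num
  rw [Real.log_mul (by positivity) (by positivity), Real.log_mul (by positivity) (by positivity),
    Real.log_mul (by positivity) (by positivity), Real.log_mul (by positivity) (by positivity),
    Real.log_mul (by positivity) (by positivity), Real.log_rpow hκ, Real.log_rpow hI,
    Real.log_rpow hπ, hl4]

theorem rhoVMF_eq (d : ℕ) (hd : 1 ≤ d) (μ : UnitSphere d) {κ : ℝ} (hκ : 0 < κ) :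
    rhoVMF d μ κ =
        besselI (((d : ℝ) - 1) / 2) (2 * κ) *
          (4 * Real.pi ^ (2 * (1 + 1 / (d : ℝ))) * (d : ℝ) *
            besselI (((d : ℝ) - 1) / 2) κ ^ (8 / (d : ℝ)) * κ ^ (2 / (d : ℝ) - 1) *
            (2 * (d : ℝ) * besselI (((d : ℝ) + 1) / 2) (2 * κ) +
              ((d : ℝ) + 2) * κ * besselI (((d : ℝ) + 3) / 2) (2 * κ))) ^
            (-((d : ℝ) / ((d : ℝ) + 4))) := by
  have hd' : (1 : ℝ) ≤ d := by exact_mod_cast hd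
  have hd0 : (0 : ℝ) < d := by linarith
  have hν : 0 ≤ ((d : ℝ) - 1) / 2 := by linarith
  have hI : 0 < besselI (((d : ℝ) - 1) / 2) κ := besselI_pos hν hκ
  have hJ0 : 0 < besselI (((d : ℝ) - 1) / 2) (2 * κ) := besselI_pos hν (by positivity)
  have hJ1 : 0 < besselI (((d : ℝ) + 1) / 2) (2 * κ) := besselI_pos (by positivity) (by positivity)
  have hJ2 : 0 < besselI (((d : ℝ) + 3) / 2) (2 * κ) := besselI_pos (by positivity) (by positivity)
  have j0 := besselI_two_mul (((d : ℝ) - 1) / 2) 0 hκ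
  have j1 := besselI_two_mul (((d : ℝ) - 1) / 2) 1 hκ
  have j2 := besselI_two_mul (((d : ℝ) - 1) / 2) 2 hκ
  rw [Real.rpow_zero, mul_one, add_zero] at j0
  rw [Real.rpow_one] at j1
  rw [Real.rpow_ofNat] at j2
  have hc := vmfConst_sq_mul_sphereConst d hd hκ
  have hκν : 0 < κ ^ (((d : ℝ) - 1) / 2) := by positivity
  set A := ((2 : ℝ) ^ d * Real.pi ^ (((d : ℝ) + 1) / 2) *
        besselI (((d : ℝ) - 1) / 2) κ ^ 2)⁻¹ with hA
  have hA0 : 0 < A := by positivity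
  have e1 : sphereR (vmfDensity d μ κ) = κ ^ (((d : ℝ) - 1) / 2) * A *
      besselI (((d : ℝ) - 1) / 2) (2 * κ) := by
    rw [sphereR_vmfDensity d hd μ κ, ← hc, j0]
    field_simp
  have e2 : sphereR (laplacianExt (vmfDensity d μ κ)) = κ ^ (((d : ℝ) - 1) / 2) * A *
      (κ * d / 4 * (2 * (d : ℝ) * besselI (((d : ℝ) + 1) / 2) (2 * κ) +
              ((d : ℝ) + 2) * κ * besselI (((d : ℝ) + 3) / 2) (2 * κ))) := by
    rw [sphereR_laplacianExt_vmfDensity d hd μ κ, ← hc,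
      show ((d : ℝ) + 1) / 2 = ((d : ℝ) - 1) / 2 + 1 by ring,
      show ((d : ℝ) + 3) / 2 = ((d : ℝ) - 1) / 2 + 2 by ring, j1, j2]
    field_simp
  set W := 2 * (d : ℝ) * besselI (((d : ℝ) + 1) / 2) (2 * κ) +
              ((d : ℝ) + 2) * κ * besselI (((d : ℝ) + 3) / 2) (2 * κ) with hW
  have hW0 : 0 < W := by positivity
  rw [rhoVMF, rhoFunctional, e1, e2]
  -- `B` is common to both values of `R`, so the quotient carries `B^{4/(d+4)} =
  -- (B^{-4/d})^{-d/(d+4)}`. Moving `B^{-4/d}` into the brace produces the exponents `8/d`,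
  -- `2(1+1/d)` and `2/d-1`.
  set B := κ ^ (((d : ℝ) - 1) / 2) * A with hB
  have hB0 : 0 < B := by positivity
  have hlogB : Real.log B = ((d : ℝ) - 1) / 2 * Real.log κ - (d * Real.log 2 +
      ((d : ℝ) + 1) / 2 * Real.log Real.pi +
        2 * Real.log (besselI (((d : ℝ) - 1) / 2) κ)) := by
    have := Real.pi_pos
    rw [hB, hA, Real.log_mul (by positivity) (by positivity), Real.log_inv,
      Real.log_mul (by positivity) (by positivity), Real.log_mul (by positivity) (by positivity),
      Real.log_rpow hκ, Real.log_rpow Real.pi_pos, Real.log_pow, Real.log_pow]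
    push_cast
    ring
  clear_value B
  have hπ := Real.pi_pos
  have hl4 : Real.log 4 = 2 * Real.log 2 := by
    rw [show (4 : ℝ) = 2 ^ 2 by norm_num, Real.log_pow]
    norm_num
  rw [Real.rpow_neg (by positivity), ← div_eq_mul_inv]
  rw [div_eq_div_iff (by positivity) (by positivity)]
  -- Both sides are positive, so after taking logarithms the claim is a linear identity in the
  -- individual logarithms.
  refine Real.log_injOn_pos (Set.mem_Ioi.mpr (by positivity)) (Set.mem_Ioi.mpr (by positivity)) ?_
  have l1 : Real.log (B * (κ * d / 4 * W)) = Real.log B + (Real.log κ + Real.log d -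
      2 * Real.log 2 + Real.log W) := by
    rw [Real.log_mul (by positivity) (by positivity), Real.log_mul (by positivity) (by positivity),
      Real.log_div (by positivity) (by positivity), Real.log_mul (by positivity) (by positivity),
      hl4]
  rw [Real.log_mul (by positivity) (by positivity), Real.log_mul (by positivity) (by positivity),
    Real.log_mul (by positivity) (by positivity), Real.log_rpow (by positivity),
    Real.log_rpow (by positivity), l1, log_rhoVMF_base d hd hκ hW0, hlogB]
  field_simp
  ring

/-- The bracket `2d I_{(d+1)/2}(2κ) + (d+2) κ I_{(d+3)/2}(2κ)`. -/
noncomputable def besselBracket (d : ℕ) (κ : ℝ) : ℝ :=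
  2 * (d : ℝ) * besselI (((d : ℝ) + 1) / 2) (2 * κ) +
    ((d : ℝ) + 2) * κ * besselI (((d : ℝ) + 3) / 2) (2 * κ)

theorem besselBracket_pos (d : ℕ) (hd : 1 ≤ d) {κ : ℝ} (hκ : 0 < κ) : 0 < besselBracket d κ := by
  have hd' : (1 : ℝ) ≤ d := by exact_mod_cast hd
  have hJ1 : 0 < besselI (((d : ℝ) + 1) / 2) (2 * κ) := besselI_pos (by positivity) (by positivity)
  have hJ2 : 0 < besselI (((d : ℝ) + 3) / 2) (2 * κ) := besselI_pos (by positivity) (by positivity)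
  unfold besselBracket
  positivity

theorem rhoVMF_eq_exp (d : ℕ) (hd : 1 ≤ d) (μ : UnitSphere d) {κ : ℝ} (hκ : 0 < κ) :
    rhoVMF d μ κ = Real.exp (Real.log (besselI (((d : ℝ) - 1) / 2) (2 * κ)) -
      (d : ℝ) / ((d : ℝ) + 4) * (2 * Real.log 2 + 2 * (1 + 1 / (d : ℝ)) * Real.log Real.pi +
        Real.log d + 8 / (d : ℝ) * Real.log (besselI (((d : ℝ) - 1) / 2) κ) +
        (2 / (d : ℝ) - 1) * Real.log κ + Real.log (besselBracket d κ))) := by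
  have hd' : (1 : ℝ) ≤ d := by exact_mod_cast hd
  have hI : 0 < besselI (((d : ℝ) - 1) / 2) κ := besselI_pos (by linarith) hκ
  have hJ0 : 0 < besselI (((d : ℝ) - 1) / 2) (2 * κ) :=
    besselI_pos (by linarith) (by positivity)
  have hW := besselBracket_pos d hd hκ
  have hπ := Real.pi_pos
  have h := rhoVMF_eq d hd μ hκ
  rw [← besselBracket] at h
  rw [h, Real.rpow_def_of_pos (by positivity), log_rhoVMF_base d hd hκ hW, Real.exp_sub,
    Real.exp_log hJ0, mul_neg, Real.exp_neg, div_eq_mul_inv]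
  congr 3
  ring

/-! ### Bessel functions at large argument. -/

section Laplace

open scoped Topology

theorem integral_rpow_mul_one_sub_rpow {a b : ℝ} (ha : 0 < a) (hb : 0 < b) :
    ∫ x in (0 : ℝ)..1, x ^ (a - 1) * (1 - x) ^ (b - 1) =
      Real.Gamma a * Real.Gamma b / Real.Gamma (a + b) := by
  have h := ProbabilityTheory.beta_eq_betaIntegralReal a b ha hb
  rw [ProbabilityTheory.beta] at h
  rw [h, Complex.betaIntegral]
  have e : ∫ x in (0 : ℝ)..1, (x : ℂ) ^ ((a : ℂ) - 1) * (1 - (x : ℂ)) ^ ((b : ℂ) - 1) =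
      ∫ x in (0 : ℝ)..1, ((x ^ (a - 1) * (1 - x) ^ (b - 1) : ℝ) : ℂ) := by
    refine intervalIntegral.integral_congr fun x hx => ?_
    rw [Set.uIcc_of_le zero_le_one] at hx
    have h1 : (0 : ℝ) ≤ 1 - x := by linarith [hx.2]
    push_cast
    rw [Complex.ofReal_cpow hx.1, Complex.ofReal_cpow h1]
    push_cast
    rfl
  rw [e, intervalIntegral.integral_ofReal, Complex.ofReal_re]

theorem integral_even_pow_mul_one_sub_sq_rpow {ν : ℝ} (hν : 1 / 2 ≤ ν) (j : ℕ) :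
    ∫ t in (-1 : ℝ)..1, t ^ (2 * j) * (1 - t ^ 2) ^ (ν - 1 / 2) =
      Real.Gamma (ν + 1 / 2) * Real.Gamma (j + 1 / 2) / Real.Gamma (j + ν + 1) := by
  have hcont : Continuous fun t : ℝ => t ^ (2 * j) * (1 - t ^ 2) ^ (ν - 1 / 2) := by
    refine (continuous_pow _).mul (Continuous.rpow_const (by fun_prop) fun _ => Or.inr ?_)
    linarith
  have hneg : ∫ t in (-1 : ℝ)..0, t ^ (2 * j) * (1 - t ^ 2) ^ (ν - 1 / 2) =
      ∫ t in (0 : ℝ)..1, t ^ (2 * j) * (1 - t ^ 2) ^ (ν - 1 / 2) := by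
    have h := intervalIntegral.integral_comp_neg (a := -1) (b := 0)
      (fun t : ℝ => t ^ (2 * j) * (1 - t ^ 2) ^ (ν - 1 / 2))
    simp only [neg_sq, pow_mul, neg_zero, neg_neg] at h ⊢
    exact h
  rw [← intervalIntegral.integral_add_adjacent_intervals (b := 0)
    (hcont.intervalIntegrable _ _) (hcont.intervalIntegrable _ _), hneg]
  have hB := integral_rpow_mul_one_sub_rpow (a := j + 1 / 2) (b := ν + 1 / 2) (by positivity)
    (by positivity)
  rw [show (j : ℝ) + 1 / 2 + (ν + 1 / 2) = j + ν + 1 by ring,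
    show ν + 1 / 2 - 1 = ν - 1 / 2 by ring] at hB
  rw [mul_comm (Real.Gamma (ν + 1 / 2)), ← hB]
  -- The substitution `u = t²` turns the Beta integral into twice the integral over `[0,1]`; the
  -- indicator of `(-∞,1]` lets the half-line change of variables apply.
  have hsub := integral_comp_rpow_Ioi_of_pos (p := 2)
    (g := (Set.Iic (1 : ℝ)).indicator fun x => x ^ ((j : ℝ) + 1 / 2 - 1) * (1 - x) ^ (ν - 1 / 2))
    (by norm_num)
  rw [setIntegral_indicator measurableSet_Iic, Set.Ioi_inter_Iic,
    ← intervalIntegral.integral_of_le zero_le_one] at hsub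
  rw [← hsub]
  have e : ∫ x in Set.Ioi (0 : ℝ), (2 * x ^ ((2 : ℝ) - 1)) • (Set.Iic (1 : ℝ)).indicator
      (fun x : ℝ => x ^ ((j : ℝ) + 1 / 2 - 1) * (1 - x) ^ (ν - 1 / 2)) (x ^ (2 : ℝ)) =
      ∫ x in Set.Ioi (0 : ℝ), (Set.Iic (1 : ℝ)).indicator
        (fun t => 2 * (t ^ (2 * j) * (1 - t ^ 2) ^ (ν - 1 / 2))) x := by
    refine setIntegral_congr_fun measurableSet_Ioi fun x hx => ?_
    have hx0 : (0 : ℝ) < x := hx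
    by_cases h1 : x ≤ 1
    · have h2 : x ^ (2 : ℝ) ≤ 1 := by
        rw [Real.rpow_ofNat]
        exact pow_le_one₀ hx0.le h1
      rw [Set.indicator_of_mem (Set.mem_Iic.mpr h2), Set.indicator_of_mem (Set.mem_Iic.mpr h1),
        ← Real.rpow_mul hx0.le, smul_eq_mul, Real.rpow_ofNat]
      have : x ^ ((2 : ℝ) - 1) * x ^ (2 * ((j : ℝ) + 1 / 2 - 1)) = x ^ (2 * j) := by
        rw [← Real.rpow_add hx0, ← Real.rpow_natCast]
        congr 1
        push_cast
        ring
      rw [← this]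
      ring
    · have h2 : ¬ x ^ (2 : ℝ) ≤ 1 := by
        rw [Real.rpow_ofNat, not_le]
        exact one_lt_pow₀ (not_le.mp h1) two_ne_zero
      rw [Set.indicator_of_notMem (by simpa using h2), Set.indicator_of_notMem (by simpa using h1),
        smul_zero]
  rw [e, setIntegral_indicator measurableSet_Iic, Set.Ioi_inter_Iic,
    ← intervalIntegral.integral_of_le zero_le_one, intervalIntegral.integral_const_mul]
  ring

theorem integral_odd_pow_mul_one_sub_sq_rpow (ν : ℝ) (j : ℕ) :
    ∫ t in (-1 : ℝ)..1, t ^ (2 * j + 1) * (1 - t ^ 2) ^ (ν - 1 / 2) = 0 := by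
  have h := intervalIntegral.integral_comp_neg (a := -1) (b := 1)
    (fun t : ℝ => t ^ (2 * j + 1) * (1 - t ^ 2) ^ (ν - 1 / 2))
  simp only [neg_sq, neg_neg, Odd.neg_pow (⟨j, rfl⟩ : Odd (2 * j + 1)), neg_mul,
    intervalIntegral.integral_neg] at h
  linarith

/-- Poisson's integral representation. -/
theorem integral_exp_mul_one_sub_sq_rpow {ν : ℝ} (hν : 1 / 2 ≤ ν) (x : ℝ) :
    ∫ t in (-1 : ℝ)..1, Real.exp (x * t) * (1 - t ^ 2) ^ (ν - 1 / 2) =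
      Real.Gamma (ν + 1 / 2) * √Real.pi * besselG ν ((x / 2) ^ 2) := by
  have hle : (-1 : ℝ) ≤ 1 := by norm_num
  have hcont : Continuous fun t : ℝ => (1 - t ^ 2) ^ (ν - 1 / 2) :=
    Continuous.rpow_const (by fun_prop) fun _ => Or.inr (by linarith)
  have h := integral_exp_mul_eq_besselG (m := volume.restrict (Set.Ioc (-1 : ℝ) 1))
    (X := fun t => t) (w := fun t : ℝ => (1 - t ^ 2) ^ (ν - 1 / 2)) (c := Real.Gamma (ν + 1 / 2))
    (ν := ν) continuous_id.aestronglyMeasurable ?_ ?_ (by linarith) ?_ ?_ x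
  · rw [intervalIntegral.integral_of_le hle, h]
  · filter_upwards [ae_restrict_mem measurableSet_Ioc] with t ht
    exact abs_le.mpr ⟨ht.1.le, ht.2⟩
  · exact (hcont.intervalIntegrable (-1) 1).1
  · intro j
    rw [← intervalIntegral.integral_of_le hle]
    exact integral_odd_pow_mul_one_sub_sq_rpow ν j
  · intro j
    rw [← intervalIntegral.integral_of_le hle]
    exact integral_even_pow_mul_one_sub_sq_rpow hν j

/-- Dominated convergence with majorant `e^{-y} y^a 2^a`, using `0 ≤ 2 - y/x ≤ 2` and `a ≥ 0`. -/
theorem tendsto_laplace_integral {a : ℝ} (ha : 0 ≤ a) :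
    Tendsto (fun x : ℝ => ∫ y in Set.Ioi (0 : ℝ), (Set.Iic (2 * x)).indicator
      (fun y => Real.exp (-y) * y ^ a * (2 - y / x) ^ a) y) atTop
      (𝓝 (2 ^ a * Real.Gamma (a + 1))) := by
  have hlim : 2 ^ a * Real.Gamma (a + 1) =
      ∫ y in Set.Ioi (0 : ℝ), Real.exp (-y) * y ^ a * 2 ^ a := by
    rw [Real.Gamma_eq_integral (by positivity), integral_mul_const, mul_comm]
    simp
  rw [hlim]
  refine tendsto_integral_filter_of_dominated_convergence
    (fun y => Real.exp (-y) * y ^ a * 2 ^ a) ?_ ?_ ?_ ?_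
  · refine Eventually.of_forall fun x => ?_
    refine Measurable.aestronglyMeasurable ?_
    exact Measurable.indicator (by fun_prop) measurableSet_Iic
  · filter_upwards [eventually_gt_atTop 0] with x hx
    filter_upwards [ae_restrict_mem measurableSet_Ioi] with y hy
    have hy0 : (0 : ℝ) < y := hy
    by_cases h : y ≤ 2 * x
    · rw [Set.indicator_of_mem (Set.mem_Iic.mpr h)]
      have h1 : 0 ≤ 2 - y / x := by
        rw [sub_nonneg, div_le_iff₀ hx]
        exact h
      have h2 : 2 - y / x ≤ 2 := by
        have : 0 < y / x := by positivity
        linarith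
      rw [Real.norm_eq_abs, abs_of_nonneg (by positivity)]
      gcongr
    · rw [Set.indicator_of_notMem (by simpa using h), norm_zero]
      positivity
  · have := Real.GammaIntegral_convergent (s := a + 1) (by positivity)
    simp only [add_sub_cancel_right] at this
    exact this.mul_const _
  · filter_upwards [ae_restrict_mem measurableSet_Ioi] with y hy
    have h1 : Tendsto (fun x : ℝ => Real.exp (-y) * y ^ a * (2 - y / x) ^ a) atTop
        (𝓝 (Real.exp (-y) * y ^ a * 2 ^ a)) := by
      have h2 : Tendsto (fun x : ℝ => 2 - y / x) atTop (𝓝 2) := by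
        simpa using (tendsto_const_nhds (x := (2 : ℝ))).sub (tendsto_const_nhds.div_atTop tendsto_id)
      exact (h2.rpow_const (Or.inr ha)).const_mul _
    refine h1.congr' ?_
    filter_upwards [eventually_ge_atTop y, eventually_ge_atTop 0] with x hx hx0
    rw [Set.indicator_of_mem]
    exact Set.mem_Iic.mpr (by linarith)

/-- Substituting `t = 1 - y/x` magnifies the endpoint `t = 1`, where `e^{xt}` concentrates. -/
theorem rpow_mul_exp_neg_mul_integral {a x : ℝ} (hx : 0 < x) :
    x ^ (a + 1) * Real.exp (-x) * ∫ t in (-1 : ℝ)..1, Real.exp (x * t) * (1 - t ^ 2) ^ a =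
      ∫ y in Set.Ioi (0 : ℝ), (Set.Iic (2 * x)).indicator
        (fun y => Real.exp (-y) * y ^ a * (2 - y / x) ^ a) y := by
  have h := intervalIntegral.integral_comp_sub_div (a := 0) (b := 2 * x)
    (fun t : ℝ => Real.exp (x * t) * (1 - t ^ 2) ^ a) hx.ne' 1
  rw [zero_div, sub_zero, mul_div_cancel_right₀ _ hx.ne', show (1 : ℝ) - 2 = -1 by norm_num,
    smul_eq_mul] at h
  rw [Real.rpow_add hx, Real.rpow_one, show x ^ a * x * Real.exp (-x) *
    ∫ t in (-1 : ℝ)..1, Real.exp (x * t) * (1 - t ^ 2) ^ a = x ^ a * Real.exp (-x) *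
    (x * ∫ t in (-1 : ℝ)..1, Real.exp (x * t) * (1 - t ^ 2) ^ a) by ring, ← h,
    ← intervalIntegral.integral_const_mul, setIntegral_indicator measurableSet_Iic,
    Set.Ioi_inter_Iic, ← intervalIntegral.integral_of_le (by positivity)]
  refine intervalIntegral.integral_congr fun y hy => ?_
  rw [Set.uIcc_of_le (by positivity)] at hy
  have h1 : 0 ≤ 2 - y / x := by
    rw [sub_nonneg, div_le_iff₀ hx]
    exact hy.2
  have h2 : 1 - (1 - y / x) ^ 2 = y / x * (2 - y / x) := by ring
  have h3 : x * (1 - y / x) = x + -y := by field_simp; ring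
  have hy0 := hy.1
  rw [h2, h3, Real.mul_rpow (by positivity) h1, Real.div_rpow hy0 hx.le, Real.exp_add, Real.exp_neg]
  have : x ^ a ≠ 0 := (Real.rpow_pos_of_pos hx a).ne'
  field_simp

theorem tendsto_besselI_of_half_le {ν : ℝ} (hν : 1 / 2 ≤ ν) :
    Tendsto (fun x : ℝ => besselI ν x * Real.exp (-x) * √(2 * Real.pi * x)) atTop (𝓝 1) := by
  have hΓ : 0 < Real.Gamma (ν + 1 / 2) := Real.Gamma_pos_of_pos (by linarith)
  have h := tendsto_laplace_integral (a := ν - 1 / 2) (by linarith)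
  rw [show ν - 1 / 2 + 1 = ν + 1 / 2 by ring] at h
  have h2 := h.const_mul ((2 : ℝ) ^ (ν - 1 / 2) * Real.Gamma (ν + 1 / 2))⁻¹
  rw [inv_mul_cancel₀ (by positivity)] at h2
  refine h2.congr' ?_
  filter_upwards [eventually_gt_atTop 0] with x hx
  have h3 := rpow_mul_exp_neg_mul_integral (a := ν - 1 / 2) hx
  rw [integral_exp_mul_one_sub_sq_rpow hν, show ν - 1 / 2 + 1 = ν + 1 / 2 by ring] at h3
  rw [← h3, besselI_eq hx, Real.div_rpow hx.le (by norm_num), Real.rpow_add hx,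
    Real.rpow_sub two_pos, ← Real.sqrt_eq_rpow, ← Real.sqrt_eq_rpow,
    Real.sqrt_mul (by positivity), Real.sqrt_mul (by positivity)]
  have h4 : √2 * √2 = (2 : ℝ) := Real.mul_self_sqrt (by norm_num)
  have h5 : (0 : ℝ) < 2 ^ ν := by positivity
  field_simp

theorem besselI_zero_eq {x : ℝ} (hx : 0 < x) :
    besselI 0 x = 2 / x * besselI 1 x + besselI 2 x := by
  rw [besselI_eq hx, besselI_eq hx, besselI_eq hx, besselG_recurrence le_rfl, Real.rpow_zero,
    Real.rpow_one, Real.rpow_ofNat]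
  norm_num
  field_simp

/-- `I_ν(x) ∼ e^x / √(2πx)` as `x → ∞`. -/
theorem tendsto_besselI_atTop {ν : ℝ} (hν : ν = 0 ∨ 1 / 2 ≤ ν) :
    Tendsto (fun x : ℝ => besselI ν x * Real.exp (-x) * √(2 * Real.pi * x)) atTop (𝓝 1) := by
  rcases hν with rfl | hν
  -- Order `0` (the case `d = 1`) would need the exponent `a = -1/2`; the recurrence expresses it by
  -- orders `1` and `2`.
  · have h1 := tendsto_besselI_of_half_le (ν := 1) (by norm_num)
    have h2 := tendsto_besselI_of_half_le (ν := 2) (by norm_num)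
    have h3 : Tendsto (fun x : ℝ => 2 / x) atTop (𝓝 0) := tendsto_const_nhds.div_atTop tendsto_id
    have h4 := (h3.mul h1).add h2
    rw [zero_mul, zero_add] at h4
    refine h4.congr' ?_
    filter_upwards [eventually_gt_atTop 0] with x hx
    rw [besselI_zero_eq hx]
    ring
  · exact tendsto_besselI_of_half_le hν

end Laplace

/-! ### The limit `κ → ∞`. -/

section Asymptotic

open scoped Topology

theorem tendsto_log_besselI_sub {ν : ℝ} (hν : ν = 0 ∨ 1 / 2 ≤ ν) :
    Tendsto (fun x : ℝ => Real.log (besselI ν x) - x +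
      1 / 2 * (Real.log 2 + Real.log Real.pi + Real.log x)) atTop (𝓝 0) := by
  have h := (tendsto_besselI_atTop hν).log one_ne_zero
  rw [Real.log_one] at h
  refine h.congr' ?_
  filter_upwards [eventually_gt_atTop 0] with x hx
  have hI : 0 < besselI ν x := besselI_pos (by rcases hν with h | h <;> linarith) hx
  have hπ := Real.pi_pos
  rw [Real.log_mul (by positivity) (by positivity), Real.log_mul hI.ne' (Real.exp_pos _).ne',
    Real.log_exp, Real.log_sqrt (by positivity), Real.log_mul (by positivity) hx.ne',
    Real.log_mul (by positivity) hπ.ne']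
  ring

theorem tendsto_two_mul_atTop : Tendsto (fun κ : ℝ => 2 * κ) atTop atTop :=
  tendsto_id.const_mul_atTop two_pos

theorem tendsto_log_besselBracket_sub (d : ℕ) (hd : 1 ≤ d) :
    Tendsto (fun κ : ℝ => Real.log (besselBracket d κ) - 2 * κ - Real.log κ +
      1 / 2 * (2 * Real.log 2 + Real.log Real.pi + Real.log κ)) atTop
      (𝓝 (Real.log ((d : ℝ) + 2))) := by
  have hd' : (1 : ℝ) ≤ d := by exact_mod_cast hd
  have h1 := (tendsto_besselI_atTop (ν := ((d : ℝ) + 1) / 2) (Or.inr (by linarith))).comp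
    tendsto_two_mul_atTop
  have h2 := (tendsto_besselI_atTop (ν := ((d : ℝ) + 3) / 2) (Or.inr (by linarith))).comp
    tendsto_two_mul_atTop
  have h3 : Tendsto (fun κ : ℝ => 2 * (d : ℝ) / κ) atTop (𝓝 0) :=
    tendsto_const_nhds.div_atTop tendsto_id
  have h4 := (h3.mul h1).add (h2.const_mul ((d : ℝ) + 2))
  rw [zero_mul, zero_add, mul_one] at h4
  refine (h4.log (by positivity)).congr' ?_
  filter_upwards [eventually_gt_atTop 0] with κ hκ
  have hW := besselBracket_pos d hd hκ
  have hπ := Real.pi_pos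
  have e : 2 * (d : ℝ) / κ * ((fun x => besselI (((d : ℝ) + 1) / 2) x * Real.exp (-x) *
      √(2 * Real.pi * x)) ∘ fun κ => 2 * κ) κ + ((d : ℝ) + 2) *
      ((fun x => besselI (((d : ℝ) + 3) / 2) x * Real.exp (-x) *
      √(2 * Real.pi * x)) ∘ fun κ => 2 * κ) κ =
      besselBracket d κ / κ * Real.exp (-(2 * κ)) * √(2 * Real.pi * (2 * κ)) := by
    simp only [Function.comp, besselBracket]
    field_simp
  rw [e, Real.log_mul (by positivity) (by positivity),
    Real.log_mul (by positivity) (Real.exp_pos _).ne', Real.log_div hW.ne' hκ.ne',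
    Real.log_exp, Real.log_sqrt (by positivity), Real.log_mul (by positivity) (by positivity),
    Real.log_mul (by positivity) hπ.ne', Real.log_mul (by positivity) hκ.ne']
  ring

theorem rhoVMF_isEquivalent_concentration (d : ℕ) (hd : 1 ≤ d) (μ : UnitSphere d) :
    (fun κ : ℝ => rhoVMF d μ κ) ~[atTop]
      (fun _ : ℝ => (4 * Real.pi ^ 2 * (d : ℝ) * ((d : ℝ) + 2)) ^
        (-((d : ℝ) / ((d : ℝ) + 4)))) := by
  have hd' : (1 : ℝ) ≤ d := by exact_mod_cast hd
  have hd0 : (0 : ℝ) < d := by linarith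
  have hπ := Real.pi_pos
  have hν : ((d : ℝ) - 1) / 2 = 0 ∨ 1 / 2 ≤ ((d : ℝ) - 1) / 2 := by
    rcases hd.eq_or_lt with h | h
    · left
      simp [← h]
    · right
      have : (2 : ℝ) ≤ d := by exact_mod_cast h
      linarith
  refine (isEquivalent_const_iff_tendsto (by positivity)).mpr ?_
  have l4 : Real.log 4 = 2 * Real.log 2 := by
    rw [show (4 : ℝ) = 2 ^ 2 by norm_num, Real.log_pow]
    norm_num
  rw [Real.rpow_def_of_pos (by positivity), Real.log_mul (by positivity) (by positivity),
    Real.log_mul (by positivity) (by positivity), Real.log_mul (by positivity) (by positivity),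
    Real.log_pow, l4]
  have h0 := tendsto_log_besselI_sub hν
  have h1 := h0.comp tendsto_two_mul_atTop
  have h2 := tendsto_log_besselBracket_sub d hd
  -- The linear terms cancel because `d/(d+4) · (8/d + 2) = 2`; the coefficients of `log κ` also sum
  -- to zero.
  have h3 := (h1.sub (((h0.const_mul (8 / (d : ℝ))).add h2).const_mul ((d : ℝ) / (d + 4)))).add_const
    (-((d : ℝ) / (d + 4)) * (2 * Real.log 2 + 2 * Real.log Real.pi + Real.log d))
  refine ((Real.continuous_exp.tendsto _).comp h3).congr' ?_ |>.trans_eq ?_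
  · filter_upwards [eventually_gt_atTop 0] with κ hκ
    rw [rhoVMF_eq_exp d hd μ hκ, Function.comp]
    congr 1
    simp only [Function.comp, Real.log_mul two_ne_zero hκ.ne']
    field_simp
    ring
  · congr 2
    push_cast
    ring

/-! ### The limit `d → ∞`. -/

theorem tendsto_log_factorial_div_sub_log :
    Tendsto (fun n : ℕ => Real.log (n.factorial : ℝ) / n - Real.log n) atTop (𝓝 (-1)) := by
  have h1 : Tendsto (fun n : ℕ => Real.log (Stirling.stirlingSeq n) / n) atTop (𝓝 0) :=
    (Stirling.tendsto_stirlingSeq_sqrt_pi.log (Real.sqrt_pos.mpr Real.pi_pos).ne').div_atTop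
      tendsto_natCast_atTop_atTop
  have h2 : Tendsto (fun n : ℕ => Real.log (n : ℝ) / n) atTop (𝓝 0) := by
    have := Real.isLittleO_log_id_atTop.tendsto_div_nhds_zero.comp
      (tendsto_natCast_atTop_atTop (R := ℝ))
    simpa [Function.comp_def] using this
  have h3 : Tendsto (fun n : ℕ => Real.log 2 / (n : ℝ)) atTop (𝓝 0) :=
    tendsto_const_nhds.div_atTop tendsto_natCast_atTop_atTop
  have h4 := (h1.add ((h2.add h3).const_mul (1 / 2))).sub_const 1
  norm_num at h4
  refine h4.congr' ?_
  filter_upwards [eventually_gt_atTop 0] with n hn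
  have hn' : (0 : ℝ) < n := by exact_mod_cast hn
  rw [Stirling.log_stirlingSeq_formula, Real.log_mul two_ne_zero hn'.ne',
    Real.log_div hn'.ne' (Real.exp_pos 1).ne', Real.log_exp]
  field_simp
  ring

/-- With `s = (d+1)/2`, duplication gives `Γ(s)Γ(s+1/2) = d! 2^{-d} √π`, and `Γ(s) ≤ Γ(s+1/2) ≤
sΓ(s)`. Monotonicity is used on `[2,∞)`, hence `d ≥ 3`. -/
theorem Gamma_half_bounds {d : ℕ} (hd : 3 ≤ d) :
    2 * Real.log (Real.Gamma (((d : ℝ) + 1) / 2)) ≤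
      Real.log (d.factorial : ℝ) - d * Real.log 2 + 1 / 2 * Real.log Real.pi ∧
    Real.log (d.factorial : ℝ) - d * Real.log 2 + 1 / 2 * Real.log Real.pi -
      Real.log (((d : ℝ) + 1) / 2) ≤ 2 * Real.log (Real.Gamma (((d : ℝ) + 1) / 2)) := by
  have hd' : (3 : ℝ) ≤ d := by exact_mod_cast hd
  have hπ := Real.pi_pos
  have hdup := Real.Gamma_mul_Gamma_add_half_of_pos (s := ((d : ℝ) + 1) / 2) (by positivity)
  rw [show 2 * (((d : ℝ) + 1) / 2) = d + 1 by ring, Real.Gamma_nat_eq_factorial,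
    show (1 : ℝ) - (d + 1) = -d by ring] at hdup
  have g1 : 0 < Real.Gamma (((d : ℝ) + 1) / 2) := Real.Gamma_pos_of_pos (by positivity)
  have g2 : 0 < Real.Gamma (((d : ℝ) + 1) / 2 + 1 / 2) := Real.Gamma_pos_of_pos (by positivity)
  have hlog := congrArg Real.log hdup
  rw [Real.log_mul g1.ne' g2.ne', Real.log_mul (by positivity) (by positivity),
    Real.log_mul (by positivity) (by positivity), Real.log_rpow two_pos,
    Real.log_sqrt hπ.le] at hlog
  have m1 := Real.Gamma_strictMonoOn_Ici.monotoneOn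
    (show ((d : ℝ) + 1) / 2 ∈ Set.Ici 2 by rw [Set.mem_Ici]; linarith)
    (show ((d : ℝ) + 1) / 2 + 1 / 2 ∈ Set.Ici 2 by rw [Set.mem_Ici]; linarith) (by linarith)
  have m2 := Real.Gamma_strictMonoOn_Ici.monotoneOn
    (show ((d : ℝ) + 1) / 2 + 1 / 2 ∈ Set.Ici 2 by rw [Set.mem_Ici]; linarith)
    (show ((d : ℝ) + 1) / 2 + 1 ∈ Set.Ici 2 by rw [Set.mem_Ici]; linarith) (by linarith)
  rw [Real.Gamma_add_one (by positivity)] at m2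
  have n1 := Real.log_le_log g1 m1
  have n2 := Real.log_le_log g2 m2
  rw [Real.log_mul (by positivity) g1.ne'] at n2
  constructor <;> linarith

theorem tendsto_log_Gamma_half_div_sub_log :
    Tendsto (fun d : ℕ => Real.log (Real.Gamma (((d : ℝ) + 1) / 2)) / d - 1 / 2 * Real.log d)
      atTop (𝓝 (-(1 / 2) * (Real.log 2 + 1))) := by
  have hs := tendsto_log_factorial_div_sub_log
  have hc : ∀ c : ℝ, Tendsto (fun n : ℕ => c / (n : ℝ)) atTop (𝓝 0) := fun c =>
    tendsto_const_nhds.div_atTop tendsto_natCast_atTop_atTop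
  have hl : Tendsto (fun d : ℕ => Real.log (((d : ℝ) + 1) / 2) / d) atTop (𝓝 0) := by
    have h2 : Tendsto (fun x : ℝ => Real.log ((x + 1) / 2) / ((x + 1) / 2)) atTop (𝓝 0) :=
      Real.isLittleO_log_id_atTop.tendsto_div_nhds_zero.comp
        ((tendsto_atTop_add_const_right _ 1 tendsto_id).atTop_div_const two_pos)
    have h3 := (h2.comp (tendsto_natCast_atTop_atTop (R := ℝ))).mul
      (((hc 1).const_add 1).mul_const (1 / 2))
    norm_num at h3
    refine h3.congr' ?_
    filter_upwards [eventually_gt_atTop 0] with n hn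
    have hn' : (0 : ℝ) < n := by exact_mod_cast hn
    field_simp
  have hup := ((hs.sub_const (Real.log 2)).add (hc (1 / 2 * Real.log Real.pi))).const_mul (1 / 2)
  have hlo := (((hs.sub_const (Real.log 2)).add (hc (1 / 2 * Real.log Real.pi))).sub
    hl).const_mul (1 / 2)
  have e : 1 / 2 * (-1 - Real.log 2 + 0) = -(1 / 2) * (Real.log 2 + 1) := by ring
  rw [sub_zero, e] at hlo
  rw [e] at hup
  refine tendsto_of_tendsto_of_tendsto_of_le_of_le' hlo hup ?_ ?_
  · filter_upwards [eventually_ge_atTop 3] with d hd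
    have hd' : (0 : ℝ) < d := by exact_mod_cast (by lia : 0 < d)
    have h := (Gamma_half_bounds hd).2
    have h2 := div_le_div_of_nonneg_right h hd'.le
    have e1 : (Real.log (d.factorial : ℝ) - d * Real.log 2 + 1 / 2 * Real.log Real.pi -
      Real.log (((d : ℝ) + 1) / 2)) / d = Real.log (d.factorial : ℝ) / d - Real.log 2 +
      1 / 2 * Real.log Real.pi / d - Real.log (((d : ℝ) + 1) / 2) / d := by
      field_simp
    rw [e1, mul_div_assoc (2 : ℝ)] at h2
    linarith
  · filter_upwards [eventually_ge_atTop 3] with d hd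
    have hd' : (0 : ℝ) < d := by exact_mod_cast (by lia : 0 < d)
    have h := (Gamma_half_bounds hd).1
    have h2 := div_le_div_of_nonneg_right h hd'.le
    have e1 : (Real.log (d.factorial : ℝ) - d * Real.log 2 + 1 / 2 * Real.log Real.pi) / d =
      Real.log (d.factorial : ℝ) / d - Real.log 2 + 1 / 2 * Real.log Real.pi / d := by
      field_simp
    rw [e1, mul_div_assoc (2 : ℝ)] at h2
    linarith

/-- `Γ(ν+1) G_ν(z) → 1` along `ν = (d-1)/2 + n`. -/
theorem tendsto_Gamma_mul_besselG {n z : ℝ} (hn : 0 ≤ n) (hz : 0 ≤ z) :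
    Tendsto (fun d : ℕ => Real.Gamma (((d : ℝ) - 1) / 2 + n + 1) *
      besselG (((d : ℝ) - 1) / 2 + n) z) atTop (𝓝 1) := by
  have hν : ∀ d : ℕ, 1 ≤ d → 0 ≤ ((d : ℝ) - 1) / 2 + n := fun d hd => by
    have : (1 : ℝ) ≤ d := by exact_mod_cast hd
    have : 0 ≤ ((d : ℝ) - 1) / 2 := by linarith
    positivity
  have h1 : Tendsto (fun d : ℕ => 1 + z * Real.exp z / (((d : ℝ) - 1) / 2 + n + 1)) atTop
      (𝓝 1) := by
    have h2 : Tendsto (fun d : ℕ => ((d : ℝ) - 1) / 2 + n + 1) atTop atTop := by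
      refine tendsto_atTop_add_const_right _ 1 (tendsto_atTop_add_const_right _ n ?_)
      exact ((tendsto_atTop_add_const_right _ (-1 : ℝ)
        tendsto_natCast_atTop_atTop)).atTop_div_const two_pos
    simpa using (tendsto_const_nhds (x := z * Real.exp z)).div_atTop h2 |>.const_add 1
  refine tendsto_of_tendsto_of_tendsto_of_le_of_le' tendsto_const_nhds h1 ?_ ?_
  · filter_upwards [eventually_ge_atTop 1] with d hd
    exact one_le_Gamma_mul_besselG (hν d hd) hz
  · filter_upwards [eventually_ge_atTop 1] with d hd
    exact Gamma_mul_besselG_le (hν d hd) hz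

/-- Isolates normalised factors `Γ(ν+1)G_ν` that tend to `1`. The second summand carries `1/(d+1)`,
so the bracket behaves like `4κ^{ν+1}/Γ(ν+1)` with `ν = (d-1)/2`. -/
theorem besselBracket_eq (d : ℕ) (hd : 1 ≤ d) {κ : ℝ} (hκ : 0 < κ) :
    besselBracket d κ = κ ^ (((d : ℝ) - 1) / 2) * κ / Real.Gamma (((d : ℝ) + 1) / 2) *
      (4 * (d / (d + 1)) * (Real.Gamma (((d : ℝ) - 1) / 2 + 1 + 1) *
        besselG (((d : ℝ) - 1) / 2 + 1) (κ ^ 2)) + 4 * κ ^ 2 * ((d + 2) / (d + 3)) * (1 / (d + 1)) *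
        (Real.Gamma (((d : ℝ) - 1) / 2 + 2 + 1) * besselG (((d : ℝ) - 1) / 2 + 2) (κ ^ 2))) := by
  have hd' : (1 : ℝ) ≤ d := by exact_mod_cast hd
  have g1 : 0 < Real.Gamma (((d : ℝ) + 1) / 2) := Real.Gamma_pos_of_pos (by positivity)
  have e1 : Real.Gamma (((d : ℝ) - 1) / 2 + 1 + 1) =
      ((d : ℝ) + 1) / 2 * Real.Gamma (((d : ℝ) + 1) / 2) := by
    rw [← Real.Gamma_add_one (by positivity)]
    congr 1
    ring
  have e2 : Real.Gamma (((d : ℝ) - 1) / 2 + 2 + 1) =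
      ((d : ℝ) + 3) / 2 * (((d : ℝ) + 1) / 2 * Real.Gamma (((d : ℝ) + 1) / 2)) := by
    rw [← Real.Gamma_add_one (by positivity), show ((d : ℝ) + 3) / 2 = ((d : ℝ) + 1) / 2 + 1 by
      ring, ← Real.Gamma_add_one (by positivity)]
    congr 1
    ring
  have j1 := besselI_two_mul (((d : ℝ) - 1) / 2) 1 hκ
  have j2 := besselI_two_mul (((d : ℝ) - 1) / 2) 2 hκ
  rw [Real.rpow_one] at j1
  rw [Real.rpow_ofNat] at j2
  rw [besselBracket, show ((d : ℝ) + 1) / 2 = ((d : ℝ) - 1) / 2 + 1 by ring,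
    show ((d : ℝ) + 3) / 2 = ((d : ℝ) - 1) / 2 + 2 by ring, j1, j2, e1, e2,
    show ((d : ℝ) - 1) / 2 + 1 = ((d : ℝ) + 1) / 2 by ring]
  field_simp
  ring

theorem tendsto_natCast_add_div (a b : ℝ) :
    Tendsto (fun d : ℕ => ((d : ℝ) + a) / (d + b)) atTop (𝓝 1) := by
  have h : Tendsto (fun d : ℕ => (d : ℝ) + b) atTop atTop :=
    tendsto_atTop_add_const_right _ b tendsto_natCast_atTop_atTop
  have h2 := ((tendsto_const_nhds (x := a - b)).div_atTop h).const_add 1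
  rw [add_zero] at h2
  refine h2.congr' ?_
  filter_upwards [h.eventually_gt_atTop 0] with d hd
  field_simp
  ring

theorem tendsto_log_besselBracket_dim {κ : ℝ} (hκ : 0 < κ) :
    Tendsto (fun d : ℕ => Real.log (besselBracket d κ) - ((((d : ℝ) - 1) / 2 + 1) * Real.log κ -
      Real.log (Real.Gamma (((d : ℝ) + 1) / 2)))) atTop (𝓝 (2 * Real.log 2)) := by
  have l4 : Real.log 4 = 2 * Real.log 2 := by
    rw [show (4 : ℝ) = 2 ^ 2 by norm_num, Real.log_pow]
    norm_num
  have hg1 := tendsto_Gamma_mul_besselG (n := 1) zero_le_one (sq_nonneg κ)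
  have hg2 := tendsto_Gamma_mul_besselG (n := 2) zero_le_two (sq_nonneg κ)
  have hq1 := (tendsto_natCast_add_div 0 1).const_mul 4
  have hq2 := (tendsto_natCast_add_div 2 3).const_mul (4 * κ ^ 2)
  have hq3 : Tendsto (fun d : ℕ => 1 / ((d : ℝ) + 1)) atTop (𝓝 0) :=
    tendsto_one_div_add_atTop_nhds_zero_nat
  have h := (hq1.mul hg1).add ((hq2.mul hq3).mul hg2)
  simp only [add_zero, mul_one, mul_zero] at h
  rw [← l4]
  refine (h.log (by norm_num)).congr' ?_
  filter_upwards [eventually_ge_atTop 1, h.eventually_const_lt (show (0 : ℝ) < 4 by norm_num)]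
    with d hd hpos
  have g1 : 0 < Real.Gamma (((d : ℝ) + 1) / 2) := Real.Gamma_pos_of_pos (by positivity)
  rw [besselBracket_eq d hd hκ, Real.log_mul (by positivity) hpos.ne',
    Real.log_div (by positivity) g1.ne', Real.log_mul (by positivity) hκ.ne', Real.log_rpow hκ]
  ring

theorem tendsto_log_besselI_dim {x : ℝ} (hx : 0 < x) :
    Tendsto (fun d : ℕ => Real.log (besselI (((d : ℝ) - 1) / 2) x) - (((d : ℝ) - 1) / 2 *
      Real.log (x / 2) - Real.log (Real.Gamma (((d : ℝ) + 1) / 2)))) atTop (𝓝 0) := by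
  have h := tendsto_Gamma_mul_besselG (n := 0) le_rfl (sq_nonneg (x / 2))
  have h2 := h.log one_ne_zero
  rw [Real.log_one] at h2
  refine h2.congr' ?_
  filter_upwards [eventually_ge_atTop 1] with d hd
  have hd' : (1 : ℝ) ≤ d := by exact_mod_cast hd
  have g1 : 0 < Real.Gamma (((d : ℝ) + 1) / 2) := Real.Gamma_pos_of_pos (by positivity)
  have g2 : 0 < besselG (((d : ℝ) - 1) / 2) ((x / 2) ^ 2) :=
    besselG_pos (by linarith) (sq_nonneg _)
  rw [add_zero, show ((d : ℝ) - 1) / 2 + 1 = ((d : ℝ) + 1) / 2 by ring, besselI_eq hx,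
    Real.log_mul g1.ne' g2.ne', Real.log_mul (by positivity) g2.ne',
    Real.log_rpow (by positivity)]
  ring

theorem rhoVMF_isEquivalent_dim {κ : ℝ} (hκ : 0 < κ) (μ : ∀ d : ℕ, UnitSphere d) :
    (fun d : ℕ => rhoVMF d (μ d) κ) ~[atTop]
      (fun d : ℕ => (d : ℝ) / (4 * Real.pi ^ 2 * Real.exp 1 ^ 2 * κ ^ 2)) := by
  have hπ := Real.pi_pos
  have l4 : Real.log 4 = 2 * Real.log 2 := by
    rw [show (4 : ℝ) = 2 ^ 2 by norm_num, Real.log_pow]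
    norm_num
  rw [isEquivalent_iff_tendsto_one (by
    filter_upwards [eventually_ge_atTop 1] with d hd
    have hd0 : (0 : ℝ) < d := by exact_mod_cast hd
    positivity)]
  have hb := tendsto_log_besselBracket_dim hκ
  have h1 := tendsto_log_besselI_dim (x := 2 * κ) (by positivity)
  have h0 := tendsto_log_besselI_dim hκ
  have hG := tendsto_log_Gamma_half_div_sub_log
  have q0 := tendsto_natCast_add_div 0 4
  have q1 := tendsto_natCast_add_div 1 4
  have q2 := tendsto_natCast_add_div (-1) 4
  have q3 : Tendsto (fun d : ℕ => 1 / ((d : ℝ) + 4)) atTop (𝓝 0) :=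
    tendsto_const_nhds.div_atTop (tendsto_atTop_add_const_right _ 4 tendsto_natCast_atTop_atTop)
  have q4 : Tendsto (fun d : ℕ => Real.log d / d) atTop (𝓝 0) := by
    have := Real.isLittleO_log_id_atTop.tendsto_div_nhds_zero.comp
      (tendsto_natCast_atTop_atTop (R := ℝ))
    simpa [Function.comp_def] using this
  -- The Gamma terms add up to `4/(d+4) · log Γ((d+1)/2)`, so `log Γ / d` is needed only up to
  -- `o(1)`. They supply `2 log d` to leading order, and the factor `d` in the brace removes one
  -- `log d`.
  have t1 := ((q0.mul hG).const_mul 4).sub ((q0.mul q4).const_mul 4)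
  -- The total coefficient of `log κ` is `-2d/(d+4) = -2 + 8/(d+4)`.
  have t2 := ((q3.const_mul 8).mul_const (Real.log κ)).add (h1.sub (q0.mul hb))
  have t3 := (q0.mul_const (2 * Real.log 2)).add (q1.mul_const (2 * Real.log Real.pi))
  have t4 := (q2.mul_const (4 * Real.log 2)).sub ((q3.mul h0).const_mul 8)
  have hmain := (((t1.add t2).sub t3).add t4).add_const
    (2 * Real.log 2 + 2 * Real.log Real.pi + 2)
  have hlim := (Real.continuous_exp.tendsto _).comp hmain
  refine hlim.congr' ?_ |>.trans_eq ?_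
  · filter_upwards [eventually_ge_atTop 1] with d hd
    have hd0 : (0 : ℝ) < d := by exact_mod_cast hd
    have e : (d : ℝ) / (4 * Real.pi ^ 2 * Real.exp 1 ^ 2 * κ ^ 2) = Real.exp (Real.log d -
        (2 * Real.log 2 + 2 * Real.log Real.pi + 2 + 2 * Real.log κ)) := by
      rw [← l4, Real.exp_sub, Real.exp_log hd0, Real.exp_add, Real.exp_add, Real.exp_add,
        Real.exp_log (by norm_num), two_mul (Real.log Real.pi), Real.exp_add, Real.exp_log hπ,
        two_mul (Real.log κ), Real.exp_add, Real.exp_log hκ, ← Real.exp_nat_mul]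
      norm_num
      ring
    rw [Pi.div_apply, e, rhoVMF_eq_exp d hd (μ d) hκ, ← Real.exp_sub, Function.comp]
    congr 1
    rw [mul_div_cancel_left₀ _ (two_ne_zero' ℝ), Real.log_div hκ.ne' two_ne_zero]
    field_simp
    ring
  · refine congrArg 𝓝 (Eq.trans ?_ Real.exp_zero)
    congr 1
    ring

end Asymptotic

theorem mainTheorem7 :
    (∀ (d : ℕ), 1 ≤ d → ∀ (μ : UnitSphere d) (κ : ℝ), 0 < κ →
      rhoVMF d μ κ =
        besselI (((d : ℝ) - 1) / 2) (2 * κ) *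
          (4 * Real.pi ^ (2 * (1 + 1 / (d : ℝ))) * (d : ℝ) *
            besselI (((d : ℝ) - 1) / 2) κ ^ (8 / (d : ℝ)) * κ ^ (2 / (d : ℝ) - 1) *
            (2 * (d : ℝ) * besselI (((d : ℝ) + 1) / 2) (2 * κ) +
              ((d : ℝ) + 2) * κ * besselI (((d : ℝ) + 3) / 2) (2 * κ))) ^
            (-((d : ℝ) / ((d : ℝ) + 4)))) ∧
    (∀ (d : ℕ), 1 ≤ d → ∀ (μ : UnitSphere d),
      (fun κ : ℝ => rhoVMF d μ κ) ~[atTop]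
        (fun _ : ℝ => (4 * Real.pi ^ 2 * (d : ℝ) * ((d : ℝ) + 2)) ^
          (-((d : ℝ) / ((d : ℝ) + 4))))) ∧
    (∀ (κ : ℝ), 0 < κ → ∀ (μ : ∀ d : ℕ, UnitSphere d),
      (fun d : ℕ => rhoVMF d (μ d) κ) ~[atTop]
        (fun d : ℕ => (d : ℝ) / (4 * Real.pi ^ 2 * Real.exp 1 ^ 2 * κ ^ 2))) :=
  ⟨fun d hd μ _ hκ => rhoVMF_eq d hd μ hκ, rhoVMF_isEquivalent_concentration,
    fun _ hκ μ => rhoVMF_isEquivalent_dim hκ μ⟩
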